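/- Let $k$ be an algebraically closed field and let $\hat G$ be a central extension of a finitely generated abelian group $G$ by a finite abelian group $N$, i.e. there is a short exact sequence $1\to N\to\hat G\to G\to 1$ with the image of $N$ central in $\hat G$. **(1)** There is a central subgroup $C\le\hat G$ of finite index such that $\hat G/C$ is abelian. Now let $C\le \hat G$ be any central subgroup of finite index, put $Q=\hat G/C$, and let $\mathfrak m$ be a maximal ideal of the group algebra $kC$. Write $H=k\hat G$ and $F=H/\mathfrak mH$. **(2)** There is a 2-cocycle $\alpha\colon Q\times Q\to k^\times$ and an isomorphism of $k$-algebras $F\cong k_\alpha Q$, where $k_\alpha Q$ is the twisted group algebra with basis $(u_q)_{q\in Q}$ and product $u_pu_q=\alpha(p,q)u_{pq}$. It can be chosen to send the image of each $g\in\hat G$ to a nonzero scalar multiple of $u_{gC}$. Suppose in addition that $Q$ is abelian, and let $x_1,\dots,x_n\in\hat G$ be elements whose images generate $Q$ (for example, lifts of standard generators of $Q$). For $P\in \mathrm{GL}_n(\mathbb Z)$ (a change of $\mathbb Z$-basis) let $y_j\in F$ be the image of $x_1^{P_{1j}}\cdots x_n^{P_{nj}}$. For an integer $d\ge 1$, a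 root of unity $\xi\in k$ of order $d$, and $k_1,\dots,k_s\in\mathbb Z/d$ with $2s\le n$, say that $(P,d,\xi,k_1,\dots,k_s)$ is a *skew normal system* if $y_1,\dots,y_n$ generate the algebra $F$ and $y_iy_j=\xi^{m_{ij}}\,y_jy_i$ for all $i,j$, where $M=(m_{ij})\in M_n(\mathbb Z/d)$ is the skew-symmetric block diagonal matrix $$M=\operatorname{diag}\left(\begin{pmatrix}0&k_1\\-k_1&0\end{pmatrix},\dots,\begin{pmatrix}0&k_s\\-k_s&0\end{pmatrix},0,\dots,0\right).$$ **(3)** A skew normal system exists; it can be chosen with all $k_i\ne0$ and $k_i\mid k_j$ in $\mathbb Z/d$ for $i\le j$. **(4)** For every skew normal system, let $l_i$ be the order of $k_i$ in the additive group $\mathbb Z/d$. Then every irreducible $F$-module $V$ satisfies $$\dim_k V=\prod_{i=1}^s l_i,\qquad \mathrm{Stab}(V)\cong\prod_{i=1}^s(\mathbb Z/l_i)^2 .$$ Here $\mathrm{Stab}(V)=\{\chi\in G_0:\chi\otimes V\cong V\}$, where $G_0$ is the group (under convolution) of those algebra homomorphisms $\chi\colon H\to k$ that vanish on the kernel of the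 counit of $kC$, and $\chi\otimes V$ is the space $V$ with $g\in\hat G$ acting as $\chi(g)g$. -/

import Mathlib

noncomputable section

namespace CentralExt

/-! ### 2-cocycles and twisted group algebras -/

/-- A 2-cocycle of a group `Q` with values in an abelian group `A` (trivial action, written
multiplicatively). -/
structure TwoCocycle (Q A : Type*) [Group Q] [CommGroup A] where
  /-- the underlying function -/
  toFun : Q → Q → A
  cocycle : ∀ g h l : Q, toFun h l * toFun g (h * l) = toFun (g * h) l * toFun g h

namespace TwoCocycle

variable {Q A : Type*} [Group Q] [CommGroup A] (α : TwoCocycle Q A)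

theorem one_left (g : Q) : α.toFun 1 g = α.toFun 1 1 := by
  have h := α.cocycle 1 1 g
  simp only [one_mul, mul_right_inj] at h
  exact h

theorem one_right (g : Q) : α.toFun g 1 = α.toFun 1 1 := by
  have h := α.cocycle g 1 1
  simp only [mul_one, mul_left_inj] at h
  exact h.symm

end TwoCocycle

/-- The vector space underlying the twisted group algebra `k_α Q`: it has basis `Q`. -/
def TwistedGroupAlgebra (k : Type*) [Field k] {Q : Type*} [Group Q]
    (_α : TwoCocycle Q kˣ) : Type _ := Q →₀ k

namespace TwistedGroupAlgebra

variable {k : Type*} [Field k] {Q : Type*} [Group Q] (α : TwoCocycle Q kˣ)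

instance : AddCommGroup (TwistedGroupAlgebra k α) := inferInstanceAs (AddCommGroup (Q →₀ k))

instance : Module k (TwistedGroupAlgebra k α) := inferInstanceAs (Module k (Q →₀ k))

/-- The basis `u_g`, `g ∈ Q`, of `k_α Q`. -/
def basis : Module.Basis Q k (TwistedGroupAlgebra k α) := Finsupp.basisSingleOne

/-- The multiplication of `k_α Q`: the bilinear map with `u_g * u_h = α(g, h) u_{gh}`. -/
def mulHom : TwistedGroupAlgebra k α →ₗ[k] TwistedGroupAlgebra k α →ₗ[k]
    TwistedGroupAlgebra k α :=
  (basis α).constr k fun g => (basis α).constr k fun h =>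
    ((α.toFun g h : kˣ) : k) • basis α (g * h)

instance : Mul (TwistedGroupAlgebra k α) := ⟨fun a b => mulHom α a b⟩

instance : One (TwistedGroupAlgebra k α) := ⟨(((α.toFun 1 1)⁻¹ : kˣ) : k) • basis α 1⟩

theorem mul_def (a b : TwistedGroupAlgebra k α) : a * b = mulHom α a b := rfl

theorem one_def : (1 : TwistedGroupAlgebra k α) =
    (((α.toFun 1 1)⁻¹ : kˣ) : k) • basis α 1 := rfl

theorem basis_mul_basis (g h : Q) :
    basis α g * basis α h = ((α.toFun g h : kˣ) : k) • basis α (g * h) := by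
  simp [mul_def, mulHom, Module.Basis.constr_basis]

theorem mulHom_basis (g h : Q) :
    mulHom α (basis α g) (basis α h) = ((α.toFun g h : kˣ) : k) • basis α (g * h) :=
  basis_mul_basis α g h

theorem one_mul_aux : mulHom α (1 : TwistedGroupAlgebra k α) = LinearMap.id := by
  refine (basis α).ext fun g => ?_
  simp [one_def, mulHom_basis, α.one_left, smul_smul]

theorem mul_one_aux : (mulHom α).flip (1 : TwistedGroupAlgebra k α) = LinearMap.id := by
  refine (basis α).ext fun g => ?_
  simp [one_def, mulHom_basis, α.one_right, smul_smul]

theorem mul_assoc_basis (g h l : Q) :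
    mulHom α (mulHom α (basis α g) (basis α h)) (basis α l) =
      mulHom α (basis α g) (mulHom α (basis α h) (basis α l)) := by
  have hc := congrArg (fun u : kˣ => (u : k)) (α.cocycle g h l)
  simp only [Units.val_mul] at hc
  simp only [mulHom_basis, map_smul, LinearMap.smul_apply, smul_smul, mul_assoc g h l]
  rw [hc, mul_comm]

theorem mul_assoc_aux (a b c : TwistedGroupAlgebra k α) :
    mulHom α (mulHom α a b) c = mulHom α a (mulHom α b c) := by
  have h1 : ∀ g h : Q, mulHom α (mulHom α (basis α g) (basis α h)) =
      (mulHom α (basis α g)).comp (mulHom α (basis α h)) := fun g h =>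
    (basis α).ext fun l => mul_assoc_basis α g h l
  have h2 : ∀ g : Q, ((mulHom α).flip c).comp (mulHom α (basis α g)) =
      (mulHom α (basis α g)).comp ((mulHom α).flip c) := fun g =>
    (basis α).ext fun h => by simpa using LinearMap.congr_fun (h1 g h) c
  have h3 : ((mulHom α).flip c).comp ((mulHom α).flip b) =
      (mulHom α).flip (mulHom α b c) :=
    (basis α).ext fun g => by simpa using LinearMap.congr_fun (h2 g) b
  simpa using LinearMap.congr_fun h3 a

instance : Ring (TwistedGroupAlgebra k α) :=
  { (inferInstance : AddCommGroup (TwistedGroupAlgebra k α)) with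
    mul := (· * ·)
    one := 1
    left_distrib := fun a b c => by simp only [mul_def, map_add]
    right_distrib := fun a b c => by simp only [mul_def, map_add, LinearMap.add_apply]
    zero_mul := fun a => by simp only [mul_def, map_zero, LinearMap.zero_apply]
    mul_zero := fun a => by simp only [mul_def, map_zero]
    mul_assoc := fun a b c => mul_assoc_aux α a b c
    one_mul := fun a => LinearMap.congr_fun (one_mul_aux α) a
    mul_one := fun a => LinearMap.congr_fun (mul_one_aux α) a }

instance : Algebra k (TwistedGroupAlgebra k α) :=
  Algebra.ofModule
    (fun r a b => by simp only [mul_def, map_smul, LinearMap.smul_apply])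
    (fun r a b => by simp only [mul_def, map_smul])

end TwistedGroupAlgebra

/-! ### Characters of a group algebra, winding automorphisms -/

section Characters

variable (k : Type*) [Field k] (E : Type*) [Group E]

/-- The algebra homomorphisms `kE → k` (equivalently, the group-like elements of the finite dual
of `kE`), with the convolution product. -/
abbrev Character : Type _ := WithConv (MonoidAlgebra k E →ₐ[k] k)

variable {k E}

theorem Character.ext_of {χ ψ : Character k E}
    (h : ∀ g : E, χ (MonoidAlgebra.single g 1) = ψ (MonoidAlgebra.single g 1)) : χ = ψ := by
  apply WithConv.ofConv_injective
  apply (MonoidAlgebra.lift k k E).symm.injective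
  ext g
  exact h g

theorem Character.one_single (g : E) :
    (1 : Character k E) (MonoidAlgebra.single g 1) = 1 := by
  rw [AlgHom.convOne_apply]
  simp

theorem Character.single_mul_single (χ : Character k E) (g h : E) :
    χ (MonoidAlgebra.single g 1) * χ (MonoidAlgebra.single h 1) =
      χ (MonoidAlgebra.single (g * h) 1) := by
  have := map_mul χ.ofConv (MonoidAlgebra.single g 1) (MonoidAlgebra.single h 1)
  rw [MonoidAlgebra.single_mul_single, one_mul] at this
  exact this.symm

theorem Character.single_one (χ : Character k E) : χ (MonoidAlgebra.single (1 : E) 1) = 1 :=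
  map_one χ.ofConv

/-- The convolution inverse: `χ⁻¹(g) = χ(g⁻¹)`, i.e. `χ` composed with the antipode. -/
instance : Inv (Character k E) :=
  ⟨fun χ => WithConv.toConv (MonoidAlgebra.lift k k E
    { toFun := fun g => χ (MonoidAlgebra.single g⁻¹ 1)
      map_one' := by rw [inv_one, χ.single_one]
      map_mul' := fun g h => by
        rw [mul_inv_rev, ← χ.single_mul_single, mul_comm] })⟩

theorem Character.inv_single (χ : Character k E) (g : E) :
    χ⁻¹ (MonoidAlgebra.single g 1) = χ (MonoidAlgebra.single g⁻¹ 1) := by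
  change MonoidAlgebra.lift k k E _ (MonoidAlgebra.single g 1) = _
  rw [MonoidAlgebra.lift_single, one_smul]
  rfl

instance : Group (Character k E) :=
  { (inferInstance : Monoid (Character k E)) with
    inv := fun χ => χ⁻¹
    inv_mul_cancel := fun χ => by
      apply Character.ext_of
      intro g
      rw [MonoidAlgebra.convMul_algHom_single_one, Character.one_single]
      exact (congrArg (· * _) (χ.inv_single g)).trans
        ((χ.single_mul_single _ _).trans (by rw [inv_mul_cancel, χ.single_one])) }

/-- The left winding endomorphism `h ↦ χ(h₁) h₂` of `kE`. The module `χ ⊗ V` is the space `V`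
on which `h` acts as `χ(h₁) h₂`, i.e. `V` pulled back along this map. -/
def winding (χ : Character k E) : MonoidAlgebra k E →ₐ[k] MonoidAlgebra k E :=
  (Algebra.TensorProduct.lid k (MonoidAlgebra k E)).toAlgHom.comp
    ((Algebra.TensorProduct.map χ.ofConv (AlgHom.id k (MonoidAlgebra k E))).comp
      (Bialgebra.comulAlgHom k (MonoidAlgebra k E)))

theorem winding_single (χ : Character k E) (g : E) :
    winding χ (MonoidAlgebra.single g 1) =
      χ (MonoidAlgebra.single g 1) • MonoidAlgebra.single g 1 := by
  simp [winding]

theorem winding_one : winding (1 : Character k E) = AlgHom.id k (MonoidAlgebra k E) := by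
  apply (MonoidAlgebra.lift k (MonoidAlgebra k E) E).symm.injective
  ext1 g
  simp [winding_single]

theorem winding_mul (χ ψ : Character k E) : winding (χ * ψ) = (winding χ).comp (winding ψ) := by
  apply (MonoidAlgebra.lift k (MonoidAlgebra k E) E).symm.injective
  ext1 g
  change winding (χ * ψ) (MonoidAlgebra.single g 1) =
    winding χ (winding ψ (MonoidAlgebra.single g 1))
  rw [winding_single, winding_single, map_smul, winding_single, smul_smul, mul_comm,
    MonoidAlgebra.convMul_algHom_single_one]

end Characters

/-! ### Fiber algebras of `kE` over `kC` -/

section Fiber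

variable {k : Type*} [Field k] {E : Type*} [Group E]

/-- The inclusion `kC → kE` for a subgroup `C` of `E`. -/
def incl (k : Type*) [Field k] {E : Type*} [Group E] (C : Subgroup E) :
    MonoidAlgebra k C →ₐ[k] MonoidAlgebra k E :=
  MonoidAlgebra.mapDomainAlgHom k k C.subtype

/-- The ideal `m H` of `H = kE`: the two-sided ideal generated by (the image of) `m ⊆ kC`
(for central `C` this is also the left ideal generated by `m`). -/
def fiberIdeal (C : Subgroup E) (m : Ideal (MonoidAlgebra k C)) : Ideal (MonoidAlgebra k E) :=
  (TwoSidedIdeal.span (incl k C '' (m : Set (MonoidAlgebra k C)))).asIdeal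

instance (C : Subgroup E) (m : Ideal (MonoidAlgebra k C)) : (fiberIdeal C m).IsTwoSided :=
  inferInstanceAs
    (TwoSidedIdeal.span (incl k C '' (m : Set (MonoidAlgebra k C)))).asIdeal.IsTwoSided

/-- The fiber algebra `H / m H`. -/
abbrev Fiber (C : Subgroup E) (m : Ideal (MonoidAlgebra k C)) : Type _ :=
  MonoidAlgebra k E ⧸ fiberIdeal C m

/-- The projection `H → H / m H`. -/
def proj (C : Subgroup E) (m : Ideal (MonoidAlgebra k C)) :
    MonoidAlgebra k E →ₐ[k] Fiber C m :=
  Ideal.Quotient.mkₐ k (fiberIdeal C m)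

/-- The image in `H / m H` of a group element. -/
def img (C : Subgroup E) (m : Ideal (MonoidAlgebra k C)) (g : E) : Fiber C m :=
  proj C m (MonoidAlgebra.single g 1)

theorem incl_single (C : Subgroup E) (c : C) (r : k) :
    incl k C (MonoidAlgebra.single c r) = MonoidAlgebra.single (c : E) r := by
  simp [incl]

/-- A character vanishes on the kernel of the counit of `kC` iff it is trivial on `C`. -/
theorem vanish_iff (C : Subgroup E) (χ : Character k E) :
    (∀ c : MonoidAlgebra k C, Coalgebra.counit (R := k) c = 0 → χ (incl k C c) = 0) ↔
      ∀ c ∈ C, χ (MonoidAlgebra.single c 1) = 1 := by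
  constructor
  · intro h c hc
    have h₁ := h (MonoidAlgebra.single ⟨c, hc⟩ 1 - MonoidAlgebra.single 1 1) (by simp)
    rw [map_sub, incl_single, incl_single] at h₁
    have h₂ := map_sub χ.ofConv (MonoidAlgebra.single c 1) (MonoidAlgebra.single (1 : E) 1)
    have h₃ := h₂.symm.trans h₁
    exact (sub_eq_zero.mp h₃).trans χ.single_one
  · intro h
    have h₁ : χ.ofConv.comp (incl k C) = Bialgebra.counitAlgHom k (MonoidAlgebra k C) := by
      apply (MonoidAlgebra.lift k k C).symm.injective
      ext c
      change χ (incl k C (MonoidAlgebra.single c 1)) =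
        Coalgebra.counit (R := k) (MonoidAlgebra.single c (1 : k))
      rw [incl_single, h c c.2]
      simp
    intro c hc
    exact (AlgHom.congr_fun h₁ c).trans hc

/-- The group `G₀` of the characters of `kE` that vanish on the kernel of the counit of `kC`. -/
def G₀ (k : Type*) [Field k] {E : Type*} [Group E] (C : Subgroup E) :
    Subgroup (Character k E) where
  carrier := {χ | ∀ c : MonoidAlgebra k C, Coalgebra.counit (R := k) c = 0 → χ (incl k C c) = 0}
  one_mem' := (vanish_iff C 1).2 fun c _ => Character.one_single c
  mul_mem' := fun {χ ψ} hχ hψ => (vanish_iff C (χ * ψ)).2 fun c hc => by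
    rw [MonoidAlgebra.convMul_algHom_single_one, (vanish_iff C χ).1 hχ c hc,
      (vanish_iff C ψ).1 hψ c hc, one_mul]
  inv_mem' := fun {χ} hχ => (vanish_iff C χ⁻¹).2 fun c hc => by
    rw [Character.inv_single, (vanish_iff C χ).1 hχ _ (inv_mem hc)]

/-- The stabilizer of the `H / m H`-module `V`: the characters `χ ∈ G₀` with `χ ⊗ V ≅ V` (as
modules over `H = kE`). -/
def stab (C : Subgroup E) (m : Ideal (MonoidAlgebra k C)) (V : Type*) [AddCommGroup V]
    [Module (Fiber C m) V] : Subgroup (Character k E) where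
  carrier := {χ | χ ∈ G₀ k C ∧ ∃ e : V ≃+ V, ∀ (h : MonoidAlgebra k E) (v : V),
    e (proj C m (winding χ h) • v) = proj C m h • e v}
  one_mem' := ⟨one_mem _, AddEquiv.refl V, fun h v => by simp [winding_one]⟩
  mul_mem' := by
    rintro χ ψ ⟨hχ, e₁, h₁⟩ ⟨hψ, e₂, h₂⟩
    refine ⟨mul_mem hχ hψ, e₁.trans e₂, fun h v => ?_⟩
    simp [winding_mul, h₁, h₂]
  inv_mem' := by
    rintro χ ⟨hχ, e, h₁⟩
    refine ⟨inv_mem hχ, e.symm, fun h v => ?_⟩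
    rw [AddEquiv.symm_apply_eq]
    have h₂ := h₁ (winding χ⁻¹ h) (e.symm v)
    rw [← AlgHom.comp_apply (winding χ), ← winding_mul, mul_inv_cancel, winding_one] at h₂
    simpa using h₂.symm

/-! ### Skew normal form -/

/-- The `n × n` matrix with diagonal blocks `[0, k₁; -k₁, 0], …, [0, kₛ; -kₛ, 0], 0, …, 0`
(it is used for `2 s ≤ n`). -/
def skewNormal {R : Type*} [AddCommGroup R] (n : ℕ) {s : ℕ} (κ : Fin s → R) :
    Matrix (Fin n) (Fin n) R :=
  Matrix.of fun i j => ∑ t : Fin s,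
    ((if (i : ℕ) = 2 * t ∧ (j : ℕ) = 2 * t + 1 then κ t else 0) -
      (if (i : ℕ) = 2 * t + 1 ∧ (j : ℕ) = 2 * t then κ t else 0))

/-- The new elements of `E` obtained from `x₁, …, xₙ` by the change of `ℤ`-basis `P`:
the `j`-th one is `x₁ ^ P₁ⱼ ⋯ xₙ ^ Pₙⱼ`. -/
def newGen {n : ℕ} (x : Fin n → E) (P : Matrix.GeneralLinearGroup (Fin n) ℤ) (j : Fin n) : E :=
  (List.ofFn fun i => x i ^ (P : Matrix (Fin n) (Fin n) ℤ) i j).prod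

/-- `ξ ∈ k` is a root of unity of order `d ≥ 1`, the images `yⱼ` in `H / m H` of the elements
obtained from `x₁, …, xₙ` by the change of basis `P` generate the algebra `H / m H`, and
`yᵢ yⱼ = ξ ^ Mᵢⱼ yⱼ yᵢ`, where the matrix `M` over `ℤ/d` is in skew normal form with
entries `κ₁, …, κₛ`. -/
structure IsSkewNormalSystem (C : Subgroup E) (m : Ideal (MonoidAlgebra k C)) {n : ℕ}
    (x : Fin n → E) (P : Matrix.GeneralLinearGroup (Fin n) ℤ) (d : ℕ) (ξ : k) {s : ℕ}
    (κ : Fin s → ZMod d) : Prop where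
  pos : 0 < d
  primitive : IsPrimitiveRoot ξ d
  le : 2 * s ≤ n
  generate : Algebra.adjoin k (Set.range fun j => img C m (newGen x P j)) = ⊤
  comm : ∀ i j : Fin n, img C m (newGen x P i) * img C m (newGen x P j) =
    ξ ^ (skewNormal n κ i j).val • (img C m (newGen x P j) * img C m (newGen x P i))

end Fiber

end CentralExt

end

open CentralExt

open scoped commutatorElement

/-! All commutators of $\hat G$ lie in the finite central group $N$, and a finitely generated group
with finitely many commutators has a center of finite index; this gives (1).

By the Nullstellensatz, $\mathfrak m$ is the kernel of a character $l$ of $C$, so in $F$ every $c\in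
C$ becomes the scalar $l(c)$. Coset representatives then span $F$ and multiply through the cocycle
of $C\to\hat G\to Q$ pushed forward along $l$; comparison with the basis of $k_\alpha Q$ gives (2).

For abelian $Q$, everything is governed by the alternating bicharacter $B(h)(g)=l([g,h])$
(`commChar`), with $gh=B(h)(g)\,hg$ in $F$. Its values are roots of unity. Their exponents lift to
an alternating integer matrix, and a skew normal form of that matrix modulo $d$
(`LinearMap.exists_basis_skewNormal`) gives (3).

For a simple module $V$, conjugation by group elements acts on $\mathrm{End}_k V$, and the operator
of $h$ is a joint eigenvector with character $B(h)$. Distinct characters give independent operators,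
equal characters give proportional ones by Schur's lemma, and all the operators together span by
Burnside's theorem. One operator for each element of the image of $B$ is therefore a basis of
$\mathrm{End}_k V$, so $(\dim V)^2=|\mathrm{im}\,B|$. An isomorphism $\chi\otimes V\cong V$ is an
eigenvector with character $\chi$, which forces $\chi\in\mathrm{im}\,B$; hence
$\mathrm{Stab}(V)\cong\mathrm{im}\,B$. The normal form identifies $\mathrm{im}\,B$ with
$\prod(\mathbb Z/l_i)^2$ (`nonempty_range_mulEquiv`), and (4) follows. -/

theorem GroupExtension.fg_of_finite {N E G : Type*} [Group N] [Finite N] [Group E] [Group G]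
    [Group.FG G] (S : GroupExtension N E G) : Group.FG E := by
  obtain ⟨T, hT, hfin⟩ := Group.fg_iff.1 ‹Group.FG G›
  choose f hf using S.rightHom_surjective
  refine Group.fg_iff.2 ⟨f '' T ∪ Set.range S.inl, ?_, (hfin.image f).union (Set.finite_range _)⟩
  rw [eq_top_iff]
  set D := Subgroup.closure (f '' T ∪ Set.range S.inl)
  have hN : ∀ e, S.rightHom e = 1 → e ∈ D := fun e he => by
    have : e ∈ S.inl.range := by rw [S.range_inl_eq_ker_rightHom]; exact he
    exact Subgroup.subset_closure (Or.inr this)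
  have hmap : D.map S.rightHom = ⊤ := by
    rw [eq_top_iff, ← hT, Subgroup.closure_le]
    intro t ht
    exact ⟨f t, Subgroup.subset_closure (Or.inl ⟨t, ht, rfl⟩), hf t⟩
  intro e _
  obtain ⟨e', he', h⟩ : S.rightHom e ∈ D.map S.rightHom := hmap ▸ Subgroup.mem_top _
  have := D.mul_mem he' (hN (e'⁻¹ * e) (by rw [map_mul, map_inv, h, inv_mul_cancel]))
  simpa using this

theorem GroupExtension.commutator_mem_range_inl {N E G : Type*} [Group N] [Group E] [CommGroup G]
    (S : GroupExtension N E G) (g h : E) : ⁅g, h⁆ ∈ S.inl.range := by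
  rw [S.range_inl_eq_ker_rightHom, MonoidHom.mem_ker, map_commutatorElement,
    commutatorElement_eq_one_iff_mul_comm, mul_comm]

theorem GroupExtension.exists_central_finiteIndex {N E G : Type*} [CommGroup N] [Finite N]
    [Group E] [CommGroup G] [Group.FG G] (S : GroupExtension N E G)
    (hS : S.inl.range ≤ Subgroup.center E) :
    ∃ C : Subgroup E, C ≤ Subgroup.center E ∧ C.FiniteIndex ∧ commutator E ≤ C := by
  have := S.fg_of_finite
  have : Finite (commutatorSet E) := by
    refine Set.Finite.subset (Set.finite_range S.inl) ?_
    rintro _ ⟨g, h, rfl⟩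
    exact S.commutator_mem_range_inl g h
  -- Finite index: the center is the intersection of the centralizers of finitely many generators,
  -- and each of these has index at most the number of commutators.
  refine ⟨Subgroup.center E, le_rfl, inferInstance, ?_⟩
  rw [commutator_eq_closure, Subgroup.closure_le]
  rintro _ ⟨g, h, rfl⟩
  exact hS (S.commutator_mem_range_inl g h)

/-- Nullstellensatz for the group algebra of a finitely generated abelian group. -/
theorem MonoidAlgebra.exists_character_of_isMaximal {k : Type*} [Field k] [IsAlgClosed k]
    {D : Type*} [CommGroup D] [Group.FG D] (m : Ideal (MonoidAlgebra k D)) (hm : m.IsMaximal) :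
    ∃ l : MonoidAlgebra k D →ₐ[k] k, ∀ a, a ∈ m ↔ l a = 0 := by
  let := Ideal.Quotient.field m
  have : Algebra.FiniteType k (MonoidAlgebra k D ⧸ m) :=
    Algebra.FiniteType.of_surjective (Ideal.Quotient.mkₐ k m) (Ideal.Quotient.mkₐ_surjective k m)
  -- Zariski's lemma: a field of finite type over `k` is finite over `k`, hence equal to `k`.
  have : Module.Finite k (MonoidAlgebra k D ⧸ m) := finite_of_finite_type_of_isJacobsonRing k _
  have hbij : Function.Bijective (algebraMap k (MonoidAlgebra k D ⧸ m)) :=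
    IsAlgClosed.algebraMap_bijective_of_isIntegral
  let e : k ≃ₐ[k] (MonoidAlgebra k D ⧸ m) := AlgEquiv.ofBijective (Algebra.ofId k _) hbij
  refine ⟨(e.symm : _ →ₐ[k] k).comp (Ideal.Quotient.mkₐ k m), fun a => ?_⟩
  rw [← Ideal.Quotient.eq_zero_iff_mem]
  simp

/-! ### The fiber algebra and the commutator bicharacter -/

namespace CentralExt

section Fiber

variable {k : Type*} [Field k] {E : Type*} [Group E]

/-- `m` is the kernel of the algebra homomorphism `kC → k` extending `l`. -/
def IsCharacterKernel {D : Type*} [Group D] (m : Ideal (MonoidAlgebra k D)) (l : D →* kˣ) : Prop :=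
  ∀ a, a ∈ m ↔ MonoidAlgebra.lift k k D ((Units.coeHom k).comp l) a = 0

/-- A subgroup of finite index in a finitely generated group is finitely generated, and a central
one is abelian, so the Nullstellensatz applies to `C`. -/
theorem exists_isCharacterKernel [IsAlgClosed k] (hE : Group.FG E) (C : Subgroup E)
    (hC : C ≤ Subgroup.center E) [C.FiniteIndex] (m : Ideal (MonoidAlgebra k C))
    (hm : m.IsMaximal) : ∃ l : C →* kˣ, IsCharacterKernel m l := by
  let : CommGroup C :=
    { (inferInstance : Group C) with
      mul_comm := fun a b => Subtype.ext ((Subgroup.mem_center_iff.1 (hC b.2) a)) }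
  have : Group.FG C := Subgroup.fg_of_index_ne_zero C
  obtain ⟨l, hl⟩ := MonoidAlgebra.exists_character_of_isMaximal (D := C) m hm
  refine ⟨MonoidHom.toHomUnits ((MonoidAlgebra.lift k k C).symm l), fun a => ?_⟩
  have : (Units.coeHom k).comp (MonoidHom.toHomUnits ((MonoidAlgebra.lift k k C).symm l)) =
      (MonoidAlgebra.lift k k C).symm l := by ext; rfl
  rw [this, Equiv.apply_symm_apply, hl]

variable (C : Subgroup E) (m : Ideal (MonoidAlgebra k C))

@[simp]
theorem img_one : img C m 1 = 1 := map_one (proj C m)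

theorem img_mul (g h : E) : img C m (g * h) = img C m g * img C m h := by
  rw [img, img, img, ← map_mul, MonoidAlgebra.single_mul_single, one_mul]

/-- `img` as a monoid homomorphism. -/
noncomputable def imgHom : E →* Fiber C m where
  toFun := img C m
  map_one' := img_one C m
  map_mul' := img_mul C m

theorem proj_surjective : Function.Surjective (proj C m) := Ideal.Quotient.mkₐ_surjective k _

theorem span_range_img : Submodule.span k (Set.range (img C m)) = ⊤ := by
  rw [eq_top_iff]
  rintro a -
  obtain ⟨a, rfl⟩ := proj_surjective C m a
  induction a using MonoidAlgebra.induction_on with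
  | of g => exact Submodule.subset_span ⟨g, rfl⟩
  | add a b ha hb => rw [map_add]; exact add_mem ha hb
  | smul r a ha => rw [map_smul]; exact Submodule.smul_mem _ _ ha

variable {C m} {l : C →* kˣ}

theorem IsCharacterKernel.img_coe (hl : IsCharacterKernel m l) (c : C) :
    img C m c = algebraMap k _ (l c : k) := by
  have h : MonoidAlgebra.single c 1 - algebraMap k _ (l c : k) ∈ m := by
    rw [hl, map_sub, AlgHom.commutes, MonoidAlgebra.lift_single]
    simp
  have h₁ : incl k C (MonoidAlgebra.single c 1 - algebraMap k _ (l c : k)) ∈ fiberIdeal C m :=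
    TwoSidedIdeal.subset_span ⟨_, h, rfl⟩
  have h₂ : proj C m (incl k C (MonoidAlgebra.single c 1 - algebraMap k _ (l c : k))) = 0 :=
    Ideal.Quotient.eq_zero_iff_mem.2 h₁
  rw [map_sub, map_sub, sub_eq_zero, AlgHom.commutes, AlgHom.commutes, incl_single] at h₂
  exact h₂

theorem IsCharacterKernel.img_coe_mul (hl : IsCharacterKernel m l) (c : C) (g : E) :
    img C m (c * g) = (l c : k) • img C m g := by
  rw [img_mul, hl.img_coe, Algebra.smul_def]

theorem IsCharacterKernel.img_eq_smul (hl : IsCharacterKernel m l) (g : E) :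
    ∃ c : kˣ, img C m g = (c : k) • img C m (g : E ⧸ C).out := by
  obtain ⟨c, hc⟩ := QuotientGroup.mk_out_eq_mul C g
  refine ⟨l c⁻¹, ?_⟩
  rw [hc, img_mul, hl.img_coe, ← Algebra.commutes, ← Algebra.smul_def, smul_smul,
    ← Units.val_mul, ← map_mul, inv_mul_cancel, map_one, Units.val_one, one_smul]

theorem IsCharacterKernel.span_range_img_out (hl : IsCharacterKernel m l) :
    Submodule.span k (Set.range fun q : E ⧸ C => img C m q.out) = ⊤ := by
  rw [eq_top_iff, ← span_range_img, Submodule.span_le]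
  rintro _ ⟨g, rfl⟩
  obtain ⟨c, hc⟩ := hl.img_eq_smul g
  rw [hc]
  exact Submodule.smul_mem _ _ (Submodule.subset_span ⟨_, rfl⟩)

theorem IsCharacterKernel.finite_fiber [C.FiniteIndex] (hl : IsCharacterKernel m l) :
    Module.Finite k (Fiber C m) :=
  ⟨Submodule.fg_def.2 ⟨_, Set.finite_range _, hl.span_range_img_out⟩⟩

/-- For central `C` containing the commutators and a character `l` of `C`, the homomorphism
`h ↦ (g ↦ l ⁅g, h⁆)`. -/
def commChar (hC : C ≤ Subgroup.center E) (hE : commutator E ≤ C) (l : C →* kˣ) :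
    E →* (E →* kˣ) :=
  have hmem : ∀ g h : E, ⁅g, h⁆ ∈ C := fun g h =>
    hE (Subgroup.commutator_mem_commutator (Subgroup.mem_top g) (Subgroup.mem_top h))
  have hcomm : ∀ g h a : E, a * ⁅g, h⁆ = ⁅g, h⁆ * a := fun g h =>
    Subgroup.mem_center_iff.1 (hC (hmem g h))
  MonoidHom.mk'
    (fun h => MonoidHom.mk' (fun g => l ⟨⁅g, h⁆, hmem g h⟩) fun g g' => by
      rw [← map_mul]
      congr 1
      apply Subtype.ext
      change ⁅g * g', h⁆ = ⁅g, h⁆ * ⁅g', h⁆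
      calc ⁅g * g', h⁆ = g * ⁅g', h⁆ * (h * g⁻¹ * h⁻¹) := by
            simp only [commutatorElement_def]; group
        _ = ⁅g', h⁆ * ⁅g, h⁆ := by rw [hcomm]; simp only [commutatorElement_def]; group
        _ = _ := hcomm _ _ _)
    fun h h' => by
      ext g
      simp only [MonoidHom.mk'_apply, MonoidHom.mul_apply]
      rw [← map_mul]
      congr 2
      apply Subtype.ext
      change ⁅g, h * h'⁆ = ⁅g, h⁆ * ⁅g, h'⁆
      calc ⁅g, h * h'⁆ = ⁅g, h⁆ * h * ⁅g, h'⁆ * h⁻¹ := by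
            simp only [commutatorElement_def]; group
        _ = _ := by rw [mul_assoc _ h, hcomm]; group

variable (hC : C ≤ Subgroup.center E) (hE : commutator E ≤ C)

theorem IsCharacterKernel.img_mul_img (hl : IsCharacterKernel m l) (g h : E) :
    img C m g * img C m h = (commChar hC hE l h g : k) • (img C m h * img C m g) := by
  have hmem : ⁅g, h⁆ ∈ C :=
    hE (Subgroup.commutator_mem_commutator (Subgroup.mem_top g) (Subgroup.mem_top h))
  rw [← img_mul, ← img_mul, show g * h = (⟨⁅g, h⁆, hmem⟩ : C) * (h * g) by
    simp [commutatorElement_def], hl.img_coe_mul]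
  rfl

theorem commChar_self (g : E) : commChar hC hE l g g = 1 := by
  have : (⟨⁅g, g⁆, hE (Subgroup.commutator_mem_commutator (Subgroup.mem_top g)
    (Subgroup.mem_top g))⟩ : C) = 1 := Subtype.ext (commutatorElement_self g)
  exact (congrArg l this).trans (map_one l)

/-- Polarization of the alternating identity at `g * h`. -/
theorem commChar_swap (g h : E) : commChar hC hE l h g = (commChar hC hE l g h)⁻¹ := by
  have := commChar_self (l := l) hC hE (g * h)
  simp only [map_mul, MonoidHom.mul_apply, commChar_self, one_mul, mul_one] at this
  exact eq_inv_of_mul_eq_one_left this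

theorem le_ker_commChar : C ≤ (commChar hC hE l).ker := by
  intro c hc
  ext g
  have : (⟨⁅g, c⁆, hE (Subgroup.commutator_mem_commutator (Subgroup.mem_top g)
    (Subgroup.mem_top c))⟩ : C) = 1 := Subtype.ext (commutatorElement_eq_one_iff_mul_comm.2
      (Subgroup.mem_center_iff.1 (hC hc) g))
  exact congrArg Units.val ((congrArg l this).trans (map_one l))

end Fiber

end CentralExt

/-! ### Skew normal form of an alternating form modulo `d` -/

/-- If `ω e f` has the smallest absolute value among the nonzero values of a bilinear form over
`ℤ`, then it divides all the values `ω e y`. -/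
theorem LinearMap.dvd_of_minimal {L : Type*} [AddCommGroup L] (ω : L →ₗ[ℤ] L →ₗ[ℤ] ℤ)
    {e f : L} (h0 : ω e f ≠ 0)
    (hmin : ∀ x y, ω x y ≠ 0 → (ω e f).natAbs ≤ (ω x y).natAbs) (y : L) : ω e f ∣ ω e y := by
  by_contra hd
  -- Division with remainder: a nonzero remainder would be a value smaller than `ω e f`.
  have h1 : ω e (y - (ω e y / ω e f) • f) = ω e y % ω e f := by
    rw [map_sub, map_smul, smul_eq_mul, Int.emod_def, mul_comm]
  have h2 := hmin e (y - (ω e y / ω e f) • f)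
    (by rw [h1]; exact fun h => hd (Int.dvd_of_emod_eq_zero h))
  rw [h1] at h2
  have h3 := Int.emod_nonneg (ω e y) h0
  have h4 := Int.emod_lt (ω e y) h0
  omega

theorem CentralExt.skewNormal_swap {R : Type*} [AddCommGroup R] (n : ℕ) {s : ℕ} (κ : Fin s → R)
    (i j : Fin n) : skewNormal n κ j i = - skewNormal n κ i j := by
  simp only [skewNormal, Matrix.of_apply, ← Finset.sum_neg_distrib, neg_sub]
  refine Finset.sum_congr rfl fun t _ => ?_
  simp only [and_comm]

section
variable {R : Type*} [AddCommGroup R] {n s : ℕ} (g : R) (κ : Fin s → R)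

/-- `Fin.cons` puts a new block in front and shifts the old ones by two indices. This and the next
identities carry the induction on the rank. -/
theorem CentralExt.skewNormal_cons_succ_succ (i j : Fin n) :
    skewNormal (n + 2) (Fin.cons g κ : Fin (s + 1) → R) i.succ.succ j.succ.succ =
      skewNormal n κ i j := by
  simp only [skewNormal, Matrix.of_apply, Fin.sum_univ_succ, Fin.cons_zero, Fin.cons_succ,
    Fin.val_succ, Fin.val_zero]
  rw [if_neg (by omega), if_neg (by omega), sub_zero, zero_add]
  refine Finset.sum_congr rfl fun t _ => ?_
  congr 1 <;> refine if_congr ?_ rfl rfl <;> omega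

theorem CentralExt.skewNormal_cons_zero_one :
    skewNormal (n + 2) (Fin.cons g κ : Fin (s + 1) → R) 0 1 = g := by
  simp [skewNormal, Fin.sum_univ_succ, mul_add]

theorem CentralExt.skewNormal_self (i : Fin n) : skewNormal n κ i i = 0 := by
  rw [skewNormal, Matrix.of_apply]
  refine Finset.sum_eq_zero fun t _ => ?_
  rw [if_neg (by omega), if_neg (by omega), sub_zero]

theorem CentralExt.skewNormal_cons_zero_succ_succ (j : Fin n) :
    skewNormal (n + 2) (Fin.cons g κ : Fin (s + 1) → R) 0 j.succ.succ = 0 := by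
  rw [skewNormal, Matrix.of_apply]
  refine Finset.sum_eq_zero fun t _ => ?_
  rw [if_neg (by simp only [Fin.val_succ, Fin.val_zero]; omega),
    if_neg (by simp only [Fin.val_succ, Fin.val_zero]; omega), sub_zero]

theorem CentralExt.skewNormal_cons_one_succ_succ (j : Fin n) :
    skewNormal (n + 2) (Fin.cons g κ : Fin (s + 1) → R) 1 j.succ.succ = 0 := by
  rw [skewNormal, Matrix.of_apply]
  refine Finset.sum_eq_zero fun t _ => ?_
  rw [if_neg (by simp only [Fin.val_succ, Fin.val_one]; omega),
    if_neg (by simp only [Fin.val_succ, Fin.val_one]; omega), sub_zero]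

end

/-- Skew normal form modulo `d` of an alternating form over `ℤ`. -/
theorem LinearMap.exists_basis_skewNormal (d : ℕ) (n : ℕ) : ∀ {L : Type*} [AddCommGroup L]
    (_ : Module.Basis (Fin n) ℤ L) (ω : L →ₗ[ℤ] L →ₗ[ℤ] ℤ), (∀ x, ω x x = 0) →
    ∃ (b : Module.Basis (Fin n) ℤ L) (s : ℕ) (κ : Fin s → ZMod d), 2 * s ≤ n ∧
      (∀ i j, ((ω (b i) (b j) : ℤ) : ZMod d) = skewNormal n κ i j) ∧
      (∀ i, κ i ≠ 0) ∧ (∀ i j, i ≤ j → κ i ∣ κ j) ∧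
      (∀ i, ∃ x y, κ i = ((ω x y : ℤ) : ZMod d)) := by
  induction n using Nat.strong_induction_on with
  | _ n ih =>
  intro L _ b₀ ω hω
  -- The induction stops once the form vanishes modulo `d`, even if it is nonzero over `ℤ`; this
  -- keeps every `κ i` nonzero.
  by_cases hz : ∀ x y, ((ω x y : ℤ) : ZMod d) = 0
  · refine ⟨b₀, 0, Fin.elim0, by omega, fun i j => ?_, fun i => i.elim0, fun i => i.elim0,
      fun i => i.elim0⟩
    rw [hz]
    simp [skewNormal]
  push Not at hz
  obtain ⟨x₀, y₀, h₀⟩ := hz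
  have hne : ∃ N, ∃ x y, ω x y ≠ 0 ∧ (ω x y).natAbs = N :=
    ⟨_, x₀, y₀, fun h => h₀ (by rw [h, Int.cast_zero]), rfl⟩
  classical
  obtain ⟨e, f, hg, hgN⟩ := Nat.find_spec hne
  have hmin : ∀ x y, ω x y ≠ 0 → (ω e f).natAbs ≤ (ω x y).natAbs := fun x y h => by
    rw [hgN]; exact Nat.find_min' hne ⟨x, y, h, rfl⟩
  have hskew : ∀ x y, ω y x = - ω x y := fun x y => by
    have := hω (x + y)
    simp only [map_add, LinearMap.add_apply, hω] at this
    linarith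
  set g := ω e f with hgdef
  have hfe : ω f e = - g := hskew e f
  -- the complement of the plane spanned by `e` and `f`
  let W : Submodule ℤ L := LinearMap.ker (ω e) ⊓ LinearMap.ker (ω f)
  have hW : ∀ w ∈ W, ω e w = 0 ∧ ω f w = 0 := fun w hw => hw
  have hWf : ∀ w ∈ W, ω w f = 0 := fun w hw => by rw [hskew, (hW w hw).2, neg_zero]
  have hde : ∀ y, g ∣ ω e y := LinearMap.dvd_of_minimal ω hg hmin
  have hdf : ∀ y, g ∣ ω f y := fun y => by
    have := LinearMap.dvd_of_minimal ω (e := f) (f := e) (by rwa [hfe, neg_ne_zero])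
      (by rw [hfe, Int.natAbs_neg]; exact hmin) y
    rwa [hfe, neg_dvd] at this
  -- Replacing `e` by `e + w` leaves the value at `f` equal to `g`, so minimality applies to `e + w`
  -- as well.
  have hdW : ∀ w ∈ W, ∀ y, g ∣ ω w y := fun w hw y => by
    have h1 : ω (e + w) f = g := by rw [map_add, LinearMap.add_apply, hWf w hw, add_zero]
    have := LinearMap.dvd_of_minimal ω (e := e + w) (f := f) (by rwa [h1])
      (by rw [h1]; exact hmin) y
    rw [h1, map_add, LinearMap.add_apply] at this
    exact (dvd_add_right (hde y)).1 this
  have hdec : ∀ z, ∃ a c : ℤ, z + c • f + a • e ∈ W := fun z => by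
    obtain ⟨p, hp⟩ := hde z
    obtain ⟨q, hq⟩ := hdf z
    refine ⟨q, -p, ?_, ?_⟩
    · change ω e _ = 0
      simp only [map_add, map_smul, hω, hp, smul_eq_mul, ← hgdef]; ring
    · change ω f _ = 0
      simp only [map_add, map_smul, hω, hq, smul_eq_mul, hfe]; ring
  have hdiv : ∀ x y, g ∣ ω x y := fun x y => by
    obtain ⟨a, c, h⟩ := hdec x
    have h1 := hdW _ h y
    simp only [map_add, LinearMap.add_apply, map_smul, LinearMap.smul_apply] at h1
    have h2 := (dvd_add_left (Dvd.dvd.mul_left (hde y) a)).1 h1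
    exact (dvd_add_left (Dvd.dvd.mul_left (hdf y) c)).1 h2
  have hg0 : (g : ZMod d) ≠ 0 := fun h => h₀ (by
    obtain ⟨c, hc⟩ := hdiv x₀ y₀
    rw [hc, Int.cast_mul, h, zero_mul])
  -- Since `g` divides all values of `ω e` and `ω f`, the projection to `W` is integral. Adjoining
  -- `f` to a basis of `W` gives a basis of `ker (ω f)`, and adjoining `e` then gives one of `L`.
  have hbasis : ∀ {m : ℕ} (bW : Module.Basis (Fin m) ℤ W), ∃ b : Module.Basis (Fin (m + 2)) ℤ L,
      b 0 = e ∧ b 1 = f ∧ ∀ i : Fin m, b i.succ.succ = bW i := by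
    intro m bW
    let b₁ : Module.Basis (Fin (m + 1)) ℤ (LinearMap.ker (ω f)) :=
      Module.Basis.mkFinConsOfLE f (hω f) bW inf_le_right
        (fun c x hx h => by
          have h1 := congrArg (ω e) h
          rw [map_add, map_smul, (hW x hx).1, add_zero, map_zero, smul_eq_mul] at h1
          exact (mul_eq_zero.1 h1).resolve_right hg)
        (fun z hz => by
          obtain ⟨p, hp⟩ := hde z
          refine ⟨-p, ?_, ?_⟩
          · change ω e _ = 0
            rw [map_add, map_smul, hp, smul_eq_mul, ← hgdef]; ring
          · change ω f _ = 0
            rw [map_add, map_smul, hω, smul_zero, add_zero]; exact hz)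
    have hb₁ : ⇑b₁ = Fin.cons _ _ := Module.Basis.coe_mkFinConsOfLE _ _ _ _ _ _
    let b : Module.Basis (Fin (m + 1 + 1)) ℤ L :=
      Module.Basis.mkFinCons e b₁
        (fun c x hx h => by
          have h1 := congrArg (ω f) h
          rw [map_add, map_smul, show ω f x = 0 from hx, add_zero, map_zero, smul_eq_mul] at h1
          exact (mul_eq_zero.1 h1).resolve_right (by rw [hfe]; exact neg_ne_zero.2 hg))
        (fun z => by
          obtain ⟨q, hq⟩ := hdf z
          refine ⟨q, ?_⟩
          change ω f _ = 0
          rw [map_add, map_smul, hq, smul_eq_mul, hfe]; ring)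
    refine ⟨b, ?_, ?_, fun i => ?_⟩
    · simp [b]
    · rw [← Fin.succ_zero_eq_one]
      simp [b, hb₁]
    · simp [b, hb₁]
  -- An arbitrary basis of `W` serves only to find that its rank is `n - 2`; the induction then
  -- supplies the right one.
  obtain ⟨m, bW₀⟩ := Submodule.basisOfPid b₀ W
  obtain ⟨b₁, -⟩ := hbasis bW₀
  obtain rfl : n = m + 2 := Fin.equiv_iff_eq.1 ⟨b₀.indexEquiv b₁⟩
  obtain ⟨bW, s, κ, hs, hκ, hκ0, hκd, hκv⟩ := ih m (by omega) bW₀ (ω.domRestrict₁₂ W W)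
    fun x => hω x
  obtain ⟨b, hb0, hb1, hb⟩ := hbasis bW
  have hupper : ∀ i j, i < j → ((ω (b i) (b j) : ℤ) : ZMod d) =
      skewNormal (m + 2) (Fin.cons (g : ZMod d) κ : Fin (s + 1) → ZMod d) i j := by
    intro i j hij
    induction i using Fin.cases with
    | zero =>
      induction j using Fin.cases with
      | zero => exact absurd hij (lt_irrefl _)
      | succ j =>
        induction j using Fin.cases with
        | zero => rw [Fin.succ_zero_eq_one, skewNormal_cons_zero_one, hb0, hb1]
        | succ j =>
          rw [skewNormal_cons_zero_succ_succ, hb0, hb, (hW _ (bW j).2).1, Int.cast_zero]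
    | succ i =>
      induction j using Fin.cases with
      | zero => exact absurd hij (by simp)
      | succ j =>
        induction j using Fin.cases with
        | zero => exact absurd hij (by simp)
        | succ j =>
          induction i using Fin.cases with
          | zero =>
            rw [Fin.succ_zero_eq_one, skewNormal_cons_one_succ_succ, hb1, hb, (hW _ (bW j).2).2,
              Int.cast_zero]
          | succ i =>
            rw [skewNormal_cons_succ_succ, hb, hb]
            exact hκ i j
  refine ⟨b, s + 1, Fin.cons (g : ZMod d) κ, by omega, fun i j => ?_, ?_, ?_, ?_⟩
  · rcases lt_trichotomy i j with h | rfl | h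
    · exact hupper i j h
    · rw [skewNormal_self, hω, Int.cast_zero]
    · rw [skewNormal_swap, ← hupper j i h, hskew, Int.cast_neg]
  · exact Fin.cases hg0 hκ0
  · have hgd : ∀ i, (g : ZMod d) ∣ κ i := fun i => by
      obtain ⟨x, y, h⟩ := hκv i
      rw [h]
      exact (Int.castRingHom (ZMod d)).map_dvd (hdiv x y)
    intro i j hij
    induction i using Fin.cases with
    | zero => exact Fin.cases dvd_rfl hgd j
    | succ i =>
      induction j using Fin.cases with
      | zero => exact absurd hij (by simp)
      | succ j => exact hκd i j (by simpa using hij)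
  · exact Fin.cases ⟨e, f, rfl⟩ fun i => (hκv i).elim fun x ⟨y, h⟩ => ⟨x, y, h⟩

/-! ### The fiber algebra as a twisted group algebra -/

namespace CentralExt

section Twisted

variable {k : Type*} [Field k] {E : Type*} [Group E] {C : Subgroup E} [C.Normal]
  {m : Ideal (MonoidAlgebra k C)} {l : C →* kˣ}

theorem mul_out_inv_mem (C : Subgroup E) [C.Normal] (g : E) : g * (g : E ⧸ C).out⁻¹ ∈ C := by
  rw [← QuotientGroup.eq_one_iff]
  simp

/-- The character `l` of `C`, extended to `E` by the value `1` on the chosen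
representatives of the cosets. -/
noncomputable def cosetValue (l : C →* kˣ) (g : E) : kˣ := l ⟨_, mul_out_inv_mem C g⟩

theorem cosetValue_coe_mul (c : C) (g : E) :
    cosetValue l (c * g) = l c * cosetValue l g := by
  rw [cosetValue, cosetValue, ← map_mul]
  congr 1
  apply Subtype.ext
  have : ((c * g : E) : E ⧸ C) = g := by
    rw [QuotientGroup.mk_mul, (QuotientGroup.eq_one_iff (c : E)).2 c.2, one_mul]
  simp [this, mul_assoc]

theorem cosetValue_out (q : E ⧸ C) : cosetValue l q.out = 1 := by
  rw [cosetValue, ← map_one l]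
  congr 1
  apply Subtype.ext
  simp

theorem exists_eq_coe_mul_out (l : C →* kˣ) (g : E) :
    ∃ c : C, g = c * (g : E ⧸ C).out ∧ cosetValue l g = l c :=
  ⟨⟨_, mul_out_inv_mem C g⟩, by simp, rfl⟩

/-- The factor by which `cosetValue` fails to be multiplicative depends only on the two cosets; it
is the cocycle. -/
theorem cosetValue_mul (hC : C ≤ Subgroup.center E) (g h : E) :
    cosetValue l (g * h) = cosetValue l g * cosetValue l h *
      cosetValue l ((g : E ⧸ C).out * (h : E ⧸ C).out) := by
  obtain ⟨c, hc, hc'⟩ := exists_eq_coe_mul_out l g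
  obtain ⟨c₂, hc₂, hc₂'⟩ := exists_eq_coe_mul_out l h
  have : g * h = ((c * c₂ : C) : E) * ((g : E ⧸ C).out * (h : E ⧸ C).out) := by
    conv_lhs => rw [hc, hc₂]
    have := Subgroup.mem_center_iff.1 (hC c₂.2) (g : E ⧸ C).out
    rw [mul_assoc, ← mul_assoc _ (c₂ : E), this, Subgroup.coe_mul]
    simp only [mul_assoc]
  rw [this, cosetValue_coe_mul, map_mul, hc', hc₂']

/-- The 2-cocycle of the central extension `C → E → E ⧸ C`, pushed forward along `l`. -/
noncomputable def cosetCocycle (hC : C ≤ Subgroup.center E) (l : C →* kˣ) :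
    TwoCocycle (E ⧸ C) kˣ where
  toFun p q := cosetValue l (p.out * q.out)
  cocycle g h r := by
    -- Both sides of the cocycle identity compute the value at `g.out * h.out * r.out`, bracketed in
    -- two ways.
    have h₁ := cosetValue_mul (l := l) hC g.out (h.out * r.out)
    have h₂ := cosetValue_mul (l := l) hC (g.out * h.out) r.out
    simp only [QuotientGroup.mk_mul, QuotientGroup.out_eq', cosetValue_out, one_mul, mul_one,
      mul_assoc] at h₁ h₂
    rw [← h₁, h₂, mul_comm]

/-- The algebra homomorphism `kE → k_α Q`. -/
noncomputable def toTwisted (hC : C ≤ Subgroup.center E) (l : C →* kˣ) :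
    MonoidAlgebra k E →ₐ[k] TwistedGroupAlgebra k (cosetCocycle hC l) :=
  MonoidAlgebra.lift k _ E
    { toFun := fun g => (cosetValue l g : k) • TwistedGroupAlgebra.basis _ (g : E ⧸ C)
      map_one' := by
        rw [TwistedGroupAlgebra.one_def]
        congr 2
        have := cosetValue_mul (l := l) hC 1 1
        rw [mul_one, mul_assoc, left_eq_mul] at this
        exact eq_inv_of_mul_eq_one_left this
      map_mul' := fun g h => by
        rw [smul_mul_smul_comm, TwistedGroupAlgebra.basis_mul_basis, smul_smul,
          cosetValue_mul hC]
        rfl }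

theorem toTwisted_single (hC : C ≤ Subgroup.center E) (g : E) :
    toTwisted hC l (MonoidAlgebra.single g 1) =
      (cosetValue l g : k) • TwistedGroupAlgebra.basis _ (g : E ⧸ C) := by
  rw [toTwisted, MonoidAlgebra.lift_single, one_smul]
  rfl

theorem toTwisted_incl (hC : C ≤ Subgroup.center E) (a : MonoidAlgebra k C) :
    toTwisted hC l (incl k C a) =
      algebraMap k _ (MonoidAlgebra.lift k k C ((Units.coeHom k).comp l) a) := by
  have : (toTwisted hC l).comp (incl k C) =
      (Algebra.ofId k _).comp (MonoidAlgebra.lift k k C ((Units.coeHom k).comp l)) := by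
    apply (MonoidAlgebra.lift k _ C).symm.injective
    ext c
    change toTwisted hC l (incl k C (MonoidAlgebra.single c 1)) =
      algebraMap k _ (MonoidAlgebra.lift k k C ((Units.coeHom k).comp l)
        (MonoidAlgebra.single c 1))
    have h1 : toTwisted hC l (MonoidAlgebra.single 1 1) = 1 := map_one (toTwisted hC l)
    rw [toTwisted_single] at h1
    rw [incl_single, toTwisted_single, MonoidAlgebra.lift_single, one_smul,
      Algebra.algebraMap_eq_smul_one, ← h1, smul_smul]
    have := cosetValue_coe_mul (l := l) c 1
    rw [mul_one] at this
    rw [(QuotientGroup.eq_one_iff (c : E)).2 c.2, this]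
    rfl
  exact AlgHom.congr_fun this a

theorem fiberIdeal_le_ker_toTwisted (hC : C ≤ Subgroup.center E) (hl : IsCharacterKernel m l)
    (a : MonoidAlgebra k E) (ha : a ∈ fiberIdeal C m) : toTwisted hC l a = 0 := by
  have : TwoSidedIdeal.span (incl k C '' (m : Set (MonoidAlgebra k C))) ≤
      TwoSidedIdeal.ker (toTwisted hC l) := by
    rw [TwoSidedIdeal.span_le]
    rintro _ ⟨c, hc, rfl⟩
    rw [SetLike.mem_coe, TwoSidedIdeal.mem_ker, toTwisted_incl, (hl c).1 hc, map_zero]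
  exact (TwoSidedIdeal.mem_ker _).1 (this ha)

/-- The fiber algebra `kE / m kE` is the twisted group algebra of `E ⧸ C`. -/
noncomputable def fiberEquivTwisted (hC : C ≤ Subgroup.center E) (hl : IsCharacterKernel m l) :
    Fiber C m ≃ₐ[k] TwistedGroupAlgebra k (cosetCocycle hC l) :=
  AlgEquiv.ofBijective
    (Ideal.Quotient.liftₐ (fiberIdeal C m) (toTwisted hC l) (fiberIdeal_le_ker_toTwisted hC hl))
    (by
      set Φ := Ideal.Quotient.liftₐ (fiberIdeal C m) (toTwisted hC l)
        (fiberIdeal_le_ker_toTwisted hC hl)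
      have hΦ : ∀ q : E ⧸ C, Φ (img C m q.out) = TwistedGroupAlgebra.basis _ q := fun q => by
        change toTwisted hC l (MonoidAlgebra.single q.out 1) = _
        rw [toTwisted_single, cosetValue_out, QuotientGroup.out_eq', Units.val_one, one_smul]
      -- The inverse as a linear map. Only spanning by the representatives is needed; their
      -- independence in the fiber algebra is a consequence.
      let T := (TwistedGroupAlgebra.basis (cosetCocycle hC l)).constr k
        fun q => img C m q.out
      have h₁ : Φ.toLinearMap ∘ₗ T = LinearMap.id :=
        (TwistedGroupAlgebra.basis (cosetCocycle hC l)).ext fun q => by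
          simp [T, Module.Basis.constr_basis, hΦ]
      have h₂ : T ∘ₗ Φ.toLinearMap = LinearMap.id :=
        LinearMap.ext_on_range hl.span_range_img_out fun q => by
          simp [T, Module.Basis.constr_basis, hΦ]
      exact Function.bijective_iff_has_inverse.2
        ⟨T, LinearMap.congr_fun h₂, LinearMap.congr_fun h₁⟩)

theorem fiberEquivTwisted_img (hC : C ≤ Subgroup.center E) (hl : IsCharacterKernel m l) (g : E) :
    fiberEquivTwisted hC hl (img C m g) =
      (cosetValue l g : k) • TwistedGroupAlgebra.basis _ (g : E ⧸ C) :=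
  toTwisted_single hC g

end Twisted

end CentralExt

/-- Nonzero joint eigenvectors with distinct characters are linearly independent. -/
theorem LinearIndependent.of_characters {k W M ι : Type*} [Field k] [AddCommGroup W] [Module k W]
    [Monoid M] (T : M → W →ₗ[k] W) (χ : ι → M →* kˣ) (hχ : Function.Injective χ) (v : ι → W)
    (hv : ∀ i, v i ≠ 0) (hT : ∀ g i, T g (v i) = (χ i g : k) • v i) : LinearIndependent k v := by
  rw [linearIndependent_iff']
  intro s a ha i hi
  -- Applying a functional `φ` to the relation transported by every `T g` yields a relation between
  -- characters, to which Dedekind's theorem applies. `T` need not be multiplicative.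
  refine (smul_eq_zero.1 ((Module.forall_dual_apply_eq_zero_iff k _).1 fun φ => ?_)).resolve_right
    (hv i)
  have hli : LinearIndependent k (fun i => ((Units.coeHom k).comp (χ i) : M → k)) :=
    (linearIndependent_monoidHom M k).comp (fun i => (Units.coeHom k).comp (χ i))
      fun i j h => hχ (MonoidHom.ext fun g => Units.ext (DFunLike.congr_fun h g))
  have := linearIndependent_iff'.1 hli s (fun i => a i * φ (v i)) (by
    ext g
    have h := congrArg (fun w => φ (T g w)) ha
    simp only [map_sum, map_smul, hT, map_zero, smul_eq_mul] at h
    rw [Finset.sum_apply, Pi.zero_apply, ← h]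
    refine Finset.sum_congr rfl fun j _ => ?_
    simp only [Pi.smul_apply, smul_eq_mul, MonoidHom.comp_apply, Units.coeHom_apply]
    ring) i hi
  rw [map_smul, smul_eq_mul, this]

/-! ### Endomorphisms of a simple module as eigenvectors of conjugation -/

section SimpleModule

variable {k A V : Type*} [Field k] [Ring A] [Algebra k A] [AddCommGroup V]
  [Module k V] [Module A V] [IsScalarTower k A V]

variable {E : Type*} [Group E] {u : E →* A} {B : E →* (E →* kˣ)}

variable (k V) in
/-- The action of `u g` on `V`. -/
noncomputable def actionHom (u : E →* A) : E →* Module.End k V :=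
  ((Algebra.lsmul k k V : A →ₐ[k] Module.End k V) : A →* Module.End k V).comp u

theorem actionHom_apply (g : E) (v : V) : actionHom k V u g v = u g • v := rfl

theorem actionHom_mul_actionHom (hu : ∀ g h, u g * u h = (B h g : k) • (u h * u g)) (g h : E) :
    actionHom k V u g * actionHom k V u h =
      (B h g : k) • (actionHom k V u h * actionHom k V u g) := by
  ext v
  simp only [Module.End.mul_apply, actionHom_apply, LinearMap.smul_apply, smul_smul, hu g h,
    smul_assoc]

/-- Conjugation by the action of `g` on the endomorphisms of `V`. -/
noncomputable def conjAction (k V : Type*) {A : Type*} [Field k] [Ring A] [Algebra k A]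
    [AddCommGroup V] [Module k V] [Module A V] [IsScalarTower k A V] {E : Type*} [Group E]
    (u : E →* A) (g : E) : Module.End k V →ₗ[k] Module.End k V :=
  LinearMap.mulLeft k (actionHom k V u g) ∘ₗ LinearMap.mulRight k (actionHom k V u g⁻¹)

theorem conjAction_of_intertwine {χ : E →* kˣ} {e : Module.End k V} (g : E)
    (he : actionHom k V u g * e = (χ g : k) • (e * actionHom k V u g)) :
    conjAction k V u g e = (χ g : k) • e := by
  simp only [conjAction, LinearMap.comp_apply, LinearMap.mulLeft_apply, LinearMap.mulRight_apply]
  rw [← mul_assoc, he, smul_mul_assoc, mul_assoc, ← map_mul, mul_inv_cancel, map_one, mul_one]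

/-- Chosen representatives of the characters `B g`, acting on `V`. -/
noncomputable def actionFamily (k V : Type*) {A : Type*} [Field k] [Ring A] [Algebra k A]
    [AddCommGroup V] [Module k V] [Module A V] [IsScalarTower k A V] {E : Type*} [Group E]
    (u : E →* A) (B : E →* (E →* kˣ)) (b : B.range) : Module.End k V :=
  actionHom k V u b.2.choose

theorem conjAction_actionFamily (hu : ∀ g h, u g * u h = (B h g : k) • (u h * u g)) (g : E)
    (b : B.range) :
    conjAction k V u g (actionFamily k V u B b) = (b.1 g : k) • actionFamily k V u B b := by
  refine conjAction_of_intertwine g ?_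
  rw [actionFamily, actionHom_mul_actionHom hu, b.2.choose_spec]

variable [IsSimpleModule A V]

theorem actionHom_ne_zero (g : E) : actionHom k V u g ≠ 0 := by
  have := IsSimpleModule.nontrivial A V
  exact ((Group.isUnit g).map (actionHom k V u)).ne_zero

theorem linearIndependent_actionFamily (hu : ∀ g h, u g * u h = (B h g : k) • (u h * u g)) :
    LinearIndependent k (actionFamily k V u B) :=
  .of_characters (conjAction k V u) (fun b : B.range => b.1) Subtype.val_injective _
    (fun _ => actionHom_ne_zero _) (conjAction_actionFamily hu)

variable [IsAlgClosed k] [FiniteDimensional k V]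

/-- Burnside's theorem: over an algebraically closed field, every endomorphism of a finite
dimensional simple module is given by an element of the algebra. -/
theorem IsSimpleModule.exists_smul_eq (f : Module.End k V) : ∃ a : A, ∀ v, f v = a • v := by
  let f' : Module.End (Module.End A V) V :=
    { toFun := f
      map_add' := map_add f
      map_smul' := fun φ v => by
        obtain ⟨t, rfl⟩ := (IsSimpleModule.algebraMap_end_bijective_of_isAlgClosed (A := A) k).2 φ
        exact map_smul f t v }
  let b := Module.finBasis k V
  classical
  obtain ⟨a, ha⟩ := jacobson_density f' (Finset.univ.image b)
  refine ⟨a, LinearMap.congr_fun (g := Algebra.lsmul k k V a) (b.ext fun i => ?_)⟩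
  exact ha (b i) (Finset.mem_image_of_mem b (Finset.mem_univ i))

/-- If `u g` and `u h` differ by a central element, they act proportionally on `V`. -/
theorem actionHom_mem_span (hspan : Submodule.span k (Set.range u) = ⊤)
    (hu : ∀ g h, u g * u h = (B h g : k) • (u h * u g)) {g h : E} (hgh : B g = B h) :
    actionHom k V u g ∈ Submodule.span k {actionHom k V u h} := by
  set g' := g * h⁻¹ with hg'
  have hB : B g' = 1 := by rw [hg', map_mul, map_inv, hgh, mul_inv_cancel]
  have hcomm : ∀ a, a * u g' = u g' * a := fun a => by
    have ha : a ∈ Submodule.span k (Set.range u) := hspan ▸ Submodule.mem_top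
    induction ha using Submodule.span_induction with
    | mem _ h => obtain ⟨h, rfl⟩ := h; rw [hu, hB]; simp
    | zero => simp
    | add a b _ _ ha hb => rw [add_mul, mul_add, ha, hb]
    | smul r a _ ha => rw [smul_mul_assoc, mul_smul_comm, ha]
  -- As `B g' = 1`, `u g'` is central and acts `A`-linearly; by Schur's lemma it is a scalar.
  let φ : Module.End A V :=
    { toFun := fun v => u g' • v
      map_add' := smul_add _
      map_smul' := fun a v => by rw [RingHom.id_apply, smul_smul, smul_smul, hcomm] }
  obtain ⟨t, ht⟩ := (IsSimpleModule.algebraMap_end_bijective_of_isAlgClosed (A := A) k).2 φ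
  refine Submodule.mem_span_singleton.2 ⟨t, LinearMap.ext fun v => ?_⟩
  have h1 : t • (u h • v) = u g' • u h • v := LinearMap.congr_fun ht (u h • v)
  rw [LinearMap.smul_apply, actionHom_apply, actionHom_apply, h1, smul_smul, ← map_mul, hg',
    inv_mul_cancel_right]

theorem span_actionFamily (hspan : Submodule.span k (Set.range u) = ⊤)
    (hu : ∀ g h, u g * u h = (B h g : k) • (u h * u g)) :
    Submodule.span k (Set.range (actionFamily k V u B)) = ⊤ := by
  rw [eq_top_iff]
  rintro f -
  obtain ⟨a, ha⟩ := IsSimpleModule.exists_smul_eq (A := A) f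
  obtain rfl : f = Algebra.lsmul k k V a := LinearMap.ext ha
  have h : a ∈ Submodule.span k (Set.range u) := hspan ▸ Submodule.mem_top
  clear ha
  induction h using Submodule.span_induction with
  | mem _ h =>
    obtain ⟨g, rfl⟩ := h
    have hg : B g ∈ B.range := ⟨g, rfl⟩
    have := actionHom_mem_span (V := V) hspan hu (h := hg.choose) hg.choose_spec.symm
    exact Submodule.span_mono (Set.singleton_subset_iff.2 (Set.mem_range_self (⟨B g, hg⟩ : B.range))) this
  | zero => rw [map_zero]; exact zero_mem _
  | add a b _ _ ha hb => rw [map_add]; exact add_mem ha hb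
  | smul r a _ ha => rw [map_smul]; exact Submodule.smul_mem _ _ ha

/-- The operators in `actionFamily` form a basis of the endomorphism space, of dimension `finrank k
V ^ 2`. -/
theorem finrank_sq_eq_card_range (hspan : Submodule.span k (Set.range u) = ⊤)
    (hu : ∀ g h, u g * u h = (B h g : k) • (u h * u g)) :
    Module.finrank k V ^ 2 = Nat.card B.range := by
  rw [← Module.finrank_eq_nat_card_basis
    (Module.Basis.mk (linearIndependent_actionFamily (V := V) hu) (span_actionFamily hspan hu).ge),
    Module.finrank_linearMap, sq]

/-- Otherwise `e` would be an eigenvector with a new character, hence independent of a family that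
already spans `Module.End k V`. -/
theorem mem_range_of_intertwine (hspan : Submodule.span k (Set.range u) = ⊤)
    (hu : ∀ g h, u g * u h = (B h g : k) • (u h * u g)) {χ : E →* kˣ} {e : Module.End k V}
    (he0 : e ≠ 0) (he : ∀ g v, e ((χ g : k) • u g • v) = u g • e v) : χ ∈ B.range := by
  by_contra hχ
  have hli : LinearIndependent k
      (fun o : Option B.range => o.elim e (actionFamily k V u B)) := by
    refine .of_characters (conjAction k V u) (fun o => o.elim χ (fun b => b.1)) ?_ _ ?_ ?_
    · rintro (_ | a) (_ | b) h
      · rfl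
      · exact absurd ((show χ = b.1 from h) ▸ b.2) hχ
      · exact absurd ((show a.1 = χ from h) ▸ a.2) hχ
      · exact congrArg some (Subtype.ext h)
    · rintro (_ | a)
      · exact he0
      · exact actionHom_ne_zero _
    · rintro g (_ | a)
      · refine conjAction_of_intertwine g (LinearMap.ext fun v => ?_)
        exact (he g v).symm.trans (map_smul e _ _)
      · exact conjAction_actionFamily hu g a
  refine (linearIndependent_option.1 hli).2 ?_
  have : (fun o : Option B.range => o.elim e (actionFamily k V u B)) ∘ some =
      actionFamily k V u B := rfl
  rw [this, span_actionFamily hspan hu]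
  exact Submodule.mem_top

end SimpleModule

/-! ### The stabilizer as the image of the bicharacter -/

namespace CentralExt

section Stab

variable {k : Type*} [Field k] {E : Type*} [Group E]

/-- The restriction of a character of `kE` to `E`. -/
noncomputable def Character.toHom : Character k E →* (E →* kˣ) where
  toFun χ := MonoidHom.toHomUnits ((MonoidAlgebra.lift k k E).symm χ.ofConv)
  map_one' := MonoidHom.ext fun g => Units.ext (Character.one_single g)
  map_mul' χ ψ := MonoidHom.ext fun g => Units.ext (MonoidAlgebra.convMul_algHom_single_one χ ψ g)

theorem Character.toHom_apply (χ : Character k E) (g : E) :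
    (χ.toHom g : k) = χ (MonoidAlgebra.single g 1) := rfl

theorem Character.toHom_bijective : Function.Bijective (Character.toHom : Character k E →* _) := by
  refine ⟨fun χ ψ h => Character.ext_of fun g => ?_, fun φ => ?_⟩
  · exact congrArg Units.val (DFunLike.congr_fun h g)
  · refine ⟨WithConv.toConv (MonoidAlgebra.lift k k E ((Units.coeHom k).comp φ)),
      MonoidHom.ext fun g => Units.ext ?_⟩
    change MonoidAlgebra.lift k k E ((Units.coeHom k).comp φ) (MonoidAlgebra.single g 1) = _
    rw [MonoidAlgebra.lift_single, one_smul]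
    rfl

variable {C : Subgroup E} {m : Ideal (MonoidAlgebra k C)} {l : C →* kˣ}
  (hC : C ≤ Subgroup.center E) (hE : commutator E ≤ C)

theorem commChar_apply_of_mem (h : E) {c : E} (hc : c ∈ C) : commChar hC hE l h c = 1 := by
  rw [commChar_swap, le_ker_commChar hC hE hc, MonoidHom.one_apply, inv_one]

theorem map_stab_eq_range [IsAlgClosed k] (hl : IsCharacterKernel m l) (V : Type*) [AddCommGroup V]
    [Module k V] [Module (Fiber C m) V] [IsScalarTower k (Fiber C m) V]
    [IsSimpleModule (Fiber C m) V] [FiniteDimensional k V] :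
    (stab C m V).map Character.toHom = (commChar hC hE l).range := by
  have hspan : Submodule.span k (Set.range (imgHom C m)) = ⊤ := span_range_img C m
  have hu : ∀ g h, imgHom C m g * imgHom C m h = (commChar hC hE l h g : k) • _ :=
    hl.img_mul_img hC hE
  apply le_antisymm
  · rintro _ ⟨χ, ⟨-, e, he⟩, rfl⟩
    -- Winding fixes scalars, so the additive map `e` is automatically `k`-linear.
    have hsmul : ∀ (r : k) (v : V), e (r • v) = r • e v := fun r v => by
      have := he (algebraMap k _ r) v
      simpa only [AlgHom.commutes, algebraMap_smul] using this
    have := IsSimpleModule.nontrivial (Fiber C m) V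
    let e' : Module.End k V := { toFun := e, map_add' := map_add e, map_smul' := hsmul }
    refine mem_range_of_intertwine hspan hu (e := e') ?_ fun g v => ?_
    · intro h0
      obtain ⟨v, hv⟩ := exists_ne (0 : V)
      exact hv (e.injective ((LinearMap.congr_fun h0 v).trans (map_zero e).symm))
    · have := he (MonoidAlgebra.single g 1) v
      rw [winding_single, map_smul (proj C m), smul_assoc] at this
      exact this
  · rintro _ ⟨h, rfl⟩
    obtain ⟨χ, hχ⟩ := Character.toHom_bijective.2 (commChar hC hE l h)
    -- Conversely, the action of `h` itself intertwines the twist by `commChar hC hE l h`.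
    refine ⟨χ, ⟨(vanish_iff C χ).2 fun c hc => ?_,
      DistribMulAction.toAddEquiv V ((imgHom C m).toHomUnits h), fun a v => ?_⟩, hχ⟩
    · rw [← Character.toHom_apply, hχ, commChar_apply_of_mem hC hE h hc, Units.val_one]
    · change img C m h • (proj C m (winding χ a) • v) = proj C m a • (img C m h • v)
      induction a using MonoidAlgebra.induction_on with
      | of g =>
        change img C m h • (proj C m (winding χ (MonoidAlgebra.single g 1)) • v) =
          img C m g • (img C m h • v)
        rw [winding_single, map_smul, smul_smul, smul_smul, hl.img_mul_img hC hE g h, ← hχ,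
          Character.toHom_apply, mul_smul_comm]
        rfl
      | add a b ha hb => simp only [map_add, add_smul, smul_add, ha, hb]
      | smul r a ha =>
        have hr : ∀ (b : Fiber C m) (w : V), b • (r • w) = r • (b • w) := fun b w => by
          rw [← algebraMap_smul (Fiber C m) r w, smul_smul, ← Algebra.commutes, mul_smul,
            algebraMap_smul]
        rw [map_smul, map_smul, map_smul, smul_assoc, smul_assoc, hr, ha]

end Stab

end CentralExt

/-! ### Integer exponent vectors and changes of basis -/

section ZPowProd

theorem zpow_finsetSum {A ι : Type*} [CommGroup A] (a : A) (s : Finset ι) (f : ι → ℤ) :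
    a ^ ∑ i ∈ s, f i = ∏ i ∈ s, a ^ f i :=
  map_sum (zmultiplesHom (Additive A) (Additive.ofMul a)) f s

variable {A : Type*} [CommGroup A] {n : ℕ}

/-- The homomorphism `ℤⁿ → A` sending the standard basis to `y`. -/
def zpowProdHom (y : Fin n → A) : Multiplicative (Fin n → ℤ) →* A where
  toFun a := ∏ i, y i ^ (Multiplicative.toAdd a i)
  map_one' := by simp
  map_mul' a b := by simp [zpow_add, Finset.prod_mul_distrib]

theorem zpowProdHom_apply (y : Fin n → A) (a : Multiplicative (Fin n → ℤ)) :
    zpowProdHom y a = ∏ i, y i ^ (Multiplicative.toAdd a i) := rfl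

theorem prod_zpow_mem_closure (y : Fin n → A) (a : Fin n → ℤ) :
    ∏ i, y i ^ a i ∈ Subgroup.closure (Set.range y) :=
  Subgroup.prod_mem _ fun i _ => Subgroup.zpow_mem _ (Subgroup.subset_closure (Set.mem_range_self i)) _

theorem range_zpowProdHom (y : Fin n → A) :
    (zpowProdHom y).range = Subgroup.closure (Set.range y) := by
  apply le_antisymm
  · rintro _ ⟨a, rfl⟩
    exact prod_zpow_mem_closure y (Multiplicative.toAdd a)
  · rw [Subgroup.closure_le]
    rintro _ ⟨i, rfl⟩
    refine ⟨Multiplicative.ofAdd (Pi.single i 1), ?_⟩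
    rw [zpowProdHom_apply, Finset.prod_eq_single i]
    · simp
    · intro j _ hj
      simp [Pi.single_eq_of_ne hj]
    · simp

theorem prod_prod_zpow (x : Fin n → A) (P Q : Matrix (Fin n) (Fin n) ℤ) (i : Fin n) :
    ∏ j, (∏ a, x a ^ P a j) ^ Q j i = ∏ a, x a ^ (P * Q) a i := by
  simp only [← Finset.prod_zpow, ← zpow_mul]
  rw [Finset.prod_comm]
  refine Finset.prod_congr rfl fun a _ => ?_
  rw [Matrix.mul_apply, ← zpow_finsetSum]

theorem closure_range_prod_zpow (x : Fin n → A) (P : Matrix.GeneralLinearGroup (Fin n) ℤ) :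
    Subgroup.closure (Set.range fun j => ∏ i, x i ^ (P : Matrix (Fin n) (Fin n) ℤ) i j) =
      Subgroup.closure (Set.range x) := by
  apply le_antisymm
  · rw [Subgroup.closure_le]
    rintro _ ⟨j, rfl⟩
    exact prod_zpow_mem_closure x _
  · rw [Subgroup.closure_le]
    rintro _ ⟨i, rfl⟩
    have h := prod_prod_zpow x (P : Matrix (Fin n) (Fin n) ℤ)
      ((P⁻¹ : Matrix.GeneralLinearGroup (Fin n) ℤ) : Matrix (Fin n) (Fin n) ℤ) i
    have h1 : ∏ a, x a ^ (1 : Matrix (Fin n) (Fin n) ℤ) a i = x i := by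
      rw [Finset.prod_eq_single i (fun j _ hj => by rw [Matrix.one_apply_ne hj, zpow_zero])
        (by simp), Matrix.one_apply_eq, zpow_one]
    rw [← Units.val_mul, mul_inv_cancel, Units.val_one, h1] at h
    rw [SetLike.mem_coe, ← h]
    exact prod_zpow_mem_closure _ _

end ZPowProd

/-! ### The image of a bicharacter in skew normal form -/

namespace CentralExt

section PlaneCoordinates

variable {n s : ℕ} {R : Type*}

/-- The first index of the `t`-th block. -/
def fstIdx (hs : 2 * s ≤ n) (t : Fin s) : Fin n := ⟨2 * t, by omega⟩

/-- The second index of the `t`-th block. -/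
def sndIdx (hs : 2 * s ≤ n) (t : Fin s) : Fin n := ⟨2 * t + 1, by omega⟩

theorem sum_skewNormal_mul [Ring R] (hs : 2 * s ≤ n) (κ : Fin s → R) (a : Fin n → R) (j : Fin n) :
    ∑ i, skewNormal n κ j i * a i =
      ∑ t, ((if j = fstIdx hs t then κ t * a (sndIdx hs t) else 0) -
        (if j = sndIdx hs t then κ t * a (fstIdx hs t) else 0)) := by
  simp only [skewNormal, Matrix.of_apply, Finset.sum_mul]
  rw [Finset.sum_comm]
  refine Finset.sum_congr rfl fun t _ => ?_
  have h0 : ∀ i : Fin n, (i : ℕ) = 2 * t ↔ i = fstIdx hs t := fun i => by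
    rw [Fin.ext_iff, fstIdx]
  have h1 : ∀ i : Fin n, (i : ℕ) = 2 * t + 1 ↔ i = sndIdx hs t := fun i => by
    rw [Fin.ext_iff, sndIdx]
  simp only [h0, h1, sub_mul, ite_mul, zero_mul, ite_and, Finset.sum_sub_distrib]
  congr 1 <;> split_ifs <;> simp

/-- The two rows of a block each have a single possibly nonzero entry, `κ t` or `-κ t`, and isolate
one coordinate each. -/
theorem sum_skewNormal_mul_eq_zero_iff [Ring R] (hs : 2 * s ≤ n) (κ : Fin s → R) (a : Fin n → R) :
    (∀ j, ∑ i, skewNormal n κ j i * a i = 0) ↔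
      ∀ t, κ t * a (fstIdx hs t) = 0 ∧ κ t * a (sndIdx hs t) = 0 := by
  simp only [sum_skewNormal_mul hs]
  constructor
  · intro h t
    constructor
    · have := h (sndIdx hs t)
      rw [Finset.sum_eq_single t, if_pos rfl, if_neg, zero_sub, neg_eq_zero] at this
      · exact this
      · simp only [fstIdx, sndIdx, Fin.ext_iff]; omega
      · intro t' _ ht
        have := Fin.val_ne_of_ne ht
        rw [if_neg, if_neg, sub_zero] <;> simp only [fstIdx, sndIdx, Fin.ext_iff] <;> omega
      · simp
    · have := h (fstIdx hs t)
      rw [Finset.sum_eq_single t, if_pos rfl, if_neg, sub_zero] at this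
      · exact this
      · simp only [fstIdx, sndIdx, Fin.ext_iff]; omega
      · intro t' _ ht
        have := Fin.val_ne_of_ne ht
        rw [if_neg, if_neg, sub_zero] <;> simp only [fstIdx, sndIdx, Fin.ext_iff] <;> omega
      · simp
  · intro h j
    refine Finset.sum_eq_zero fun t _ => ?_
    rw [(h t).1, (h t).2]
    simp

/-- The reduction of the coordinates in the `t`-th block modulo `L t`. -/
def planeReduction (hs : 2 * s ≤ n) (L : Fin s → ℕ) :
    (Fin n → ℤ) →+ ∀ t, ZMod (L t) × ZMod (L t) where
  toFun a t := ((a (fstIdx hs t) : ℤ), (a (sndIdx hs t) : ℤ))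
  map_zero' := by ext <;> simp
  map_add' a b := by ext <;> simp

theorem planeReduction_surjective (hs : 2 * s ≤ n) (L : Fin s → ℕ) :
    Function.Surjective (planeReduction hs L) := by
  intro w
  choose u hu using fun t => ZMod.intCast_surjective (w t).1
  choose v hv using fun t => ZMod.intCast_surjective (w t).2
  -- Lifts are interleaved by parity; coordinates outside the blocks are irrelevant and set to `0`.
  refine ⟨fun i => if h : (i : ℕ) / 2 < s then
    if (i : ℕ) % 2 = 0 then u ⟨(i : ℕ) / 2, h⟩ else v ⟨(i : ℕ) / 2, h⟩ else 0, ?_⟩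
  funext t
  have h1 : 2 * (t : ℕ) / 2 = t := by omega
  have h2 : (2 * (t : ℕ) + 1) / 2 = t := by omega
  have h3 : (2 * (t : ℕ) + 1) % 2 = 1 := by omega
  simp [planeReduction, fstIdx, sndIdx, h1, h2, h3, hu, hv]

theorem planeReduction_eq_zero_iff (hs : 2 * s ≤ n) (d : ℕ) (κ : Fin s → ZMod d) (a : Fin n → ℤ) :
    planeReduction hs (fun t => addOrderOf (κ t)) a = 0 ↔
      ∀ j, ∑ i, skewNormal n κ j i * (a i : ZMod d) = 0 := by
  have key : ∀ (t : Fin s) (z : ℤ), (z : ZMod (addOrderOf (κ t))) = 0 ↔ κ t * (z : ZMod d) = 0 :=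
    fun t z => by
      rw [ZMod.intCast_zmod_eq_zero_iff_dvd, addOrderOf_dvd_iff_zsmul_eq_zero, zsmul_eq_mul,
        mul_comm]
  rw [sum_skewNormal_mul_eq_zero_iff hs κ fun i => (a i : ZMod d), funext_iff]
  refine forall_congr' fun t => ?_
  rw [← key, ← key]
  exact Prod.ext_iff

end PlaneCoordinates

/-- An alternating bicharacter of `E` in skew normal form: its image in the dual of `E`. -/
theorem nonempty_range_mulEquiv {k E : Type*} [Field k] [Group E] {B : E →* (E →* kˣ)}
    (hB : ∀ g h, B h g = (B g h)⁻¹) {n s : ℕ} {y : Fin n → E}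
    (hy : Subgroup.closure (Set.range fun j => B (y j)) = B.range) (hs : 2 * s ≤ n)
    {d : ℕ} (hd : 0 < d) {ξ : k} (hξ : IsPrimitiveRoot ξ d) {κ : Fin s → ZMod d}
    (hκ : ∀ i j, (B (y j) (y i) : k) = ξ ^ (skewNormal n κ i j).val) :
    Nonempty (B.range ≃* Multiplicative
      (∀ i : Fin s, ZMod (addOrderOf (κ i)) × ZMod (addOrderOf (κ i)))) := by
  have : NeZero d := ⟨hd.ne'⟩
  obtain ⟨ζ, rfl⟩ := hξ.isUnit hd.ne'
  rw [IsPrimitiveRoot.coe_units_iff] at hξ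
  have hκ' : ∀ i j, B (y j) (y i) = ζ ^ ((skewNormal n κ i j).val : ℤ) := fun i j => by
    rw [zpow_natCast]
    exact Units.ext (by rw [hκ, Units.val_pow_eq_pow_val])
  let Θ := zpowProdHom fun j => B (y j)
  let π := AddMonoidHom.toMultiplicative (planeReduction hs fun t => addOrderOf (κ t))
  have hΘ : Θ.range = B.range := (range_zpowProdHom _).trans hy
  have hker : Θ.ker = π.ker := by
    ext a
    -- The `y j` need not generate `E`. Writing `Θ a = B w` and swapping arguments, it suffices that
    -- the `B (y j)` generate the image of `B`.
    have h1 : Θ a = 1 ↔ ∀ j, Θ a (y j) = 1 := by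
      refine ⟨fun h j => by rw [h, MonoidHom.one_apply], fun h => ?_⟩
      obtain ⟨w, hw⟩ : Θ a ∈ B.range := hΘ ▸ ⟨a, rfl⟩
      rw [← hw] at h ⊢
      have hle : B.range ≤ (MonoidHom.eval (M := E) (N := kˣ) w).ker := by
        rw [← hy, Subgroup.closure_le]
        rintro _ ⟨j, rfl⟩
        change B (y j) w = 1
        rw [hB, h, inv_one]
      ext g
      have : B g w = 1 := hle ⟨g, rfl⟩
      rw [hB, this, inv_one, MonoidHom.one_apply]
    have h2 : ∀ j, Θ a (y j) = 1 ↔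
        ∑ i, skewNormal n κ j i * ((Multiplicative.toAdd a i : ℤ) : ZMod d) = 0 := fun j => by
      have : Θ a (y j) =
          ζ ^ (∑ i, ((skewNormal n κ j i).val : ℤ) * Multiplicative.toAdd a i) := by
        simp only [Θ, zpowProdHom_apply, MonoidHom.finsetProd_apply, MonoidHom.zpow_apply, hκ',
          ← zpow_mul, ← zpow_finsetSum]
      rw [this, hξ.zpow_eq_one_iff_dvd, ← ZMod.intCast_zmod_eq_zero_iff_dvd]
      simp
    rw [MonoidHom.mem_ker, h1, forall_congr' h2, ← planeReduction_eq_zero_iff hs]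
    rfl
  have hπ : Function.Surjective π := planeReduction_surjective hs _
  exact ⟨(MulEquiv.subgroupCongr hΘ.symm).trans ((QuotientGroup.quotientKerEquivRange Θ).symm.trans
    ((QuotientGroup.quotientMulEquivOfEq hker).trans
      (QuotientGroup.quotientKerEquivOfSurjective π hπ)))⟩

/-- The product defining `newGen` is ordered because `E` is not abelian; the order disappears in an
abelian target. -/
theorem map_newGen {E A : Type*} [Group E] [CommGroup A] (φ : E →* A) {n : ℕ} (x : Fin n → E)
    (P : Matrix.GeneralLinearGroup (Fin n) ℤ) (j : Fin n) :
    φ (newGen x P j) = ∏ i, φ (x i) ^ (P : Matrix (Fin n) (Fin n) ℤ) i j := by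
  rw [newGen, map_list_prod, List.map_ofFn, List.prod_ofFn]
  simp

theorem eq_top_of_closure_mk {E : Type*} [Group E] {C K : Subgroup E} [C.Normal] {ι : Type*}
    {x : ι → E} (hx : Subgroup.closure (Set.range fun i => (x i : E ⧸ C)) = ⊤) (hCK : C ≤ K)
    (hK : ∀ i, x i ∈ K) : K = ⊤ := by
  have h : K.map (QuotientGroup.mk' C) = ⊤ := by
    rw [eq_top_iff, ← hx, Subgroup.closure_le]
    rintro _ ⟨i, rfl⟩
    exact ⟨x i, hK i, rfl⟩
  have := congrArg (Subgroup.comap (QuotientGroup.mk' C)) h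
  rwa [Subgroup.comap_map_eq_self (by rwa [QuotientGroup.ker_mk']), Subgroup.comap_top] at this

/-! ### Existence and consequences of skew normal systems -/

section Main

variable {k : Type*} [Field k] {E : Type*} [Group E] {C : Subgroup E} [C.Normal]
  {m : Ideal (MonoidAlgebra k C)} {l : C →* kˣ}

theorem closure_range_commChar_newGen (hC : C ≤ Subgroup.center E) (hE : commutator E ≤ C) {n : ℕ}
    {x : Fin n → E} (hx : Subgroup.closure (Set.range fun i => (x i : E ⧸ C)) = ⊤)
    (P : Matrix.GeneralLinearGroup (Fin n) ℤ) :
    Subgroup.closure (Set.range fun j => commChar hC hE l (newGen x P j)) =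
      (commChar hC hE l).range := by
  simp only [map_newGen]
  rw [closure_range_prod_zpow fun i => commChar hC hE l (x i)]
  apply le_antisymm
  · rw [Subgroup.closure_le]
    rintro _ ⟨i, rfl⟩
    exact ⟨x i, rfl⟩
  · have := eq_top_of_closure_mk hx (K := (Subgroup.closure (Set.range fun i =>
      commChar hC hE l (x i))).comap (commChar hC hE l))
      ((le_ker_commChar hC hE).trans (MonoidHom.ker_le_comap _ _))
      fun i => Subgroup.subset_closure ⟨i, rfl⟩
    rintro _ ⟨g, rfl⟩
    exact Subgroup.mem_comap.1 (this ▸ Subgroup.mem_top g)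

theorem finrank_and_stab_of_isSkewNormalSystem [IsAlgClosed k] (hC : C ≤ Subgroup.center E)
    [C.FiniteIndex] (hl : IsCharacterKernel m l) (hE : commutator E ≤ C) {n : ℕ}
    {x : Fin n → E} (hx : Subgroup.closure (Set.range fun i => (x i : E ⧸ C)) = ⊤)
    {P : Matrix.GeneralLinearGroup (Fin n) ℤ} {d : ℕ} {ξ : k} {s : ℕ} {κ : Fin s → ZMod d}
    (h : IsSkewNormalSystem C m x P d ξ κ) (V : Type*) [AddCommGroup V] [Module k V]
    [Module (Fiber C m) V] [IsScalarTower k (Fiber C m) V] [IsSimpleModule (Fiber C m) V] :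
    Module.finrank k V = ∏ i, addOrderOf (κ i) ∧
      Nonempty (stab C m V ≃* Multiplicative
        (∀ i : Fin s, ZMod (addOrderOf (κ i)) × ZMod (addOrderOf (κ i)))) := by
  have := hl.finite_fiber
  have := IsSimpleModule.nontrivial (Fiber C m) V
  have : Nontrivial (Fiber C m) := Module.nontrivial (Fiber C m) V
  have : Module.Finite k V := Module.Finite.trans (Fiber C m) V
  obtain ⟨e⟩ := nonempty_range_mulEquiv (commChar_swap hC hE)
    (closure_range_commChar_newGen (l := l) hC hE hx P) h.le h.pos h.primitive fun i j => by
      have h1 := h.comm i j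
      rw [hl.img_mul_img hC hE] at h1
      -- The commutation rule of the system and that of `commChar` are compared on the image of a
      -- group element, a unit of the nonzero fiber algebra, so the scalars agree.
      rw [← sub_eq_zero, ← sub_smul] at h1
      rw [← sub_eq_zero]
      refine (smul_eq_zero.1 h1).resolve_right ?_
      rw [← img_mul]
      exact ((Group.isUnit _).map (imgHom C m)).ne_zero
  refine ⟨?_, ⟨((stab C m V).equivMapOfInjective _ Character.toHom_bijective.1).trans
    ((MulEquiv.subgroupCongr (map_stab_eq_range hC hE hl V)).trans e)⟩⟩
  have h1 : Module.finrank k V ^ 2 = _ :=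
    finrank_sq_eq_card_range (u := imgHom C m) (span_range_img C m) (hl.img_mul_img hC hE)
  rw [Nat.card_congr e.toEquiv, Nat.card_congr Multiplicative.toAdd, Nat.card_pi] at h1
  simp only [Nat.card_prod, Nat.card_zmod, ← sq, Finset.prod_pow] at h1
  exact Nat.pow_left_injective two_ne_zero h1

/-- Since `g ^ C.index` lies in `C` and becomes a scalar, the image of `g⁻¹` is a scalar multiple of
a nonnegative power of the image of `g`. The subalgebra is thus closed under inverses of group
elements. -/
theorem adjoin_img_newGen [C.FiniteIndex] (hl : IsCharacterKernel m l) (hE : commutator E ≤ C)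
    {n : ℕ} {x : Fin n → E}
    (hx : Subgroup.closure (Set.range fun i => (x i : E ⧸ C)) = ⊤)
    (P : Matrix.GeneralLinearGroup (Fin n) ℤ) :
    Algebra.adjoin k (Set.range fun j => img C m (newGen x P j)) = ⊤ := by
  set S := Algebra.adjoin k (Set.range fun j => img C m (newGen x P j))
  have hCS : ∀ c ∈ C, img C m c ∈ S := fun c hc => by
    rw [hl.img_coe ⟨c, hc⟩]
    exact S.algebraMap_mem _
  let K : Subgroup E :=
    { S.toSubmonoid.comap (imgHom C m) with
      inv_mem' := fun {g} hg => by
        have h1 : g⁻¹ = g ^ (C.index - 1) * (g ^ C.index)⁻¹ := by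
          rw [eq_mul_inv_iff_mul_eq, inv_mul_eq_iff_eq_mul, ← pow_succ',
            Nat.sub_add_cancel (Nat.one_le_iff_ne_zero.2 Subgroup.FiniteIndex.index_ne_zero)]
        change img C m g⁻¹ ∈ S
        rw [h1, img_mul]
        refine S.mul_mem ?_ (hCS _ (inv_mem (C.pow_index_mem g)))
        change imgHom C m _ ∈ S
        rw [map_pow]
        exact S.pow_mem hg _ }
  let _ : CommGroup (E ⧸ C) :=
    { (inferInstance : Group (E ⧸ C)) with
      mul_comm := (Subgroup.Normal.quotient_commutative_iff_commutator_le.2 hE).is_comm.comm }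
  have hy : Subgroup.closure (Set.range fun j => ((newGen x P j : E) : E ⧸ C)) = ⊤ := by
    rw [← hx, ← closure_range_prod_zpow (fun i => (x i : E ⧸ C)) P]
    exact congrArg (fun f => Subgroup.closure (Set.range f))
      (funext fun j => map_newGen (QuotientGroup.mk' C) x P j)
  have hK : K = ⊤ := eq_top_of_closure_mk hy hCS fun j => Algebra.subset_adjoin ⟨j, rfl⟩
  rw [← Algebra.toSubmodule_eq_top, eq_top_iff, ← span_range_img, Submodule.span_le]
  rintro _ ⟨g, rfl⟩
  have : g ∈ K := hK ▸ Subgroup.mem_top g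
  exact this

theorem commChar_pow_index (hC : C ≤ Subgroup.center E) (hE : commutator E ≤ C) (g h : E) :
    commChar hC hE l h g ^ C.index = 1 := by
  rw [← map_pow]
  exact commChar_apply_of_mem hC hE h (C.pow_index_mem g)

theorem exists_isSkewNormalSystem (hC : C ≤ Subgroup.center E)
    [C.FiniteIndex] (hl : IsCharacterKernel m l) (hE : commutator E ≤ C) {n : ℕ}
    {x : Fin n → E} (hx : Subgroup.closure (Set.range fun i => (x i : E ⧸ C)) = ⊤) :
    ∃ (P : Matrix.GeneralLinearGroup (Fin n) ℤ) (d : ℕ) (ξ : k) (s : ℕ) (κ : Fin s → ZMod d),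
      IsSkewNormalSystem C m x P d ξ κ ∧ (∀ i, κ i ≠ 0) ∧ (∀ i j, i ≤ j → κ i ∣ κ j) := by
  have : NeZero C.index := ⟨Subgroup.FiniteIndex.index_ne_zero⟩
  -- The commutator scalars are roots of unity of order dividing `C.index`, which form a cyclic
  -- group. The modulus `d` is `orderOf ζ`, which may be smaller than `C.index` in positive
  -- characteristic.
  obtain ⟨⟨ζ, hζ⟩, hgen⟩ := IsCyclic.exists_generator (α := rootsOfUnity C.index k)
  have hzpow : ∀ g h, ∃ z : ℤ, commChar hC hE l h g = ζ ^ z := fun g h => by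
    obtain ⟨z, hz⟩ := hgen ⟨_, commChar_pow_index (l := l) hC hE g h⟩
    exact ⟨z, (congrArg Subtype.val hz).symm⟩
  have hd : 0 < orderOf ζ :=
    orderOf_pos_iff.2 (isOfFinOrder_iff_pow_eq_one.2 ⟨_, Nat.pos_of_neZero _, hζ⟩)
  have : NeZero (orderOf ζ) := ⟨hd.ne'⟩
  choose z hz using fun i j => hzpow (x i) (x j)
  -- The exponents `z i j` are only determined modulo `orderOf ζ`. Using those above the diagonal
  -- and reflecting them makes `A` skew-symmetric over `ℤ`.
  let A : Matrix (Fin n) (Fin n) ℤ := Matrix.of fun i j =>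
    if i < j then z i j else if j < i then - z j i else 0
  have hA : ∀ i j, commChar hC hE l (x j) (x i) = ζ ^ A i j := fun i j => by
    rcases lt_trichotomy i j with h | rfl | h
    · simp only [A, Matrix.of_apply, if_pos h, hz]
    · simp [A, commChar_self]
    · simp only [A, Matrix.of_apply, if_neg h.not_gt, if_pos h]
      rw [commChar_swap, hz, zpow_neg]
  have hAskew : ∀ i j, A j i = - A i j := fun i j => by
    rcases lt_trichotomy i j with h | rfl | h
    · simp [A, h, h.not_gt]
    · simp [A]
    · simp [A, h, h.not_gt]
  let ω := Matrix.toBilin' A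
  have hω : ∀ v w, ω v w = ∑ i, ∑ j, v i * A i j * w j := Matrix.toBilin'_apply A
  have hωalt : ∀ v, ω v v = 0 := fun v => by
    have : ω v v = - ω v v := by
      conv_lhs => rw [hω, Finset.sum_comm]
      rw [hω, ← Finset.sum_neg_distrib]
      refine Finset.sum_congr rfl fun i _ => ?_
      rw [← Finset.sum_neg_distrib]
      refine Finset.sum_congr rfl fun j _ => ?_
      rw [hAskew i j]
      ring
    linarith
  obtain ⟨b, s, κ, hs, hκ, hκ0, hκd, -⟩ :=
    LinearMap.exists_basis_skewNormal (orderOf ζ) n (Pi.basisFun ℤ (Fin n)) ω hωalt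
  -- The columns of `P` are the new basis vectors, matching the exponents `P i j` in `newGen`.
  let P : Matrix.GeneralLinearGroup (Fin n) ℤ :=
    ⟨(Pi.basisFun ℤ (Fin n)).toMatrix b, b.toMatrix (Pi.basisFun ℤ (Fin n)),
      Module.Basis.toMatrix_mul_toMatrix_flip _ _, Module.Basis.toMatrix_mul_toMatrix_flip _ _⟩
  have hP : ∀ i j, (P : Matrix (Fin n) (Fin n) ℤ) i j = b j i := fun i j => by
    simp [P, Module.Basis.toMatrix_apply]
  have hcomm : ∀ i j, commChar hC hE l (newGen x P j) (newGen x P i) =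
      ζ ^ (skewNormal n κ i j).val := fun i j => by
    have h1 : commChar hC hE l (newGen x P j) (newGen x P i) = ζ ^ ω (b i) (b j) := by
      rw [map_newGen (commChar hC hE l) x P j, MonoidHom.finsetProd_apply, hω, Finset.sum_comm,
        zpow_finsetSum]
      refine Finset.prod_congr rfl fun c _ => ?_
      rw [MonoidHom.zpow_apply, map_newGen, ← Finset.prod_zpow, zpow_finsetSum]
      refine Finset.prod_congr rfl fun a _ => ?_
      rw [hA, hP, hP, ← zpow_mul, ← zpow_mul]
      congr 1
      ring
    rw [h1, ← zpow_natCast, ← orderOf_dvd_sub_iff_zpow_eq_zpow,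
      ← ZMod.intCast_zmod_eq_zero_iff_dvd]
    simp [hκ]
  refine ⟨P, orderOf ζ, ζ, s, κ, ⟨hd, ?_, hs, adjoin_img_newGen hl hE hx P, fun i j => ?_⟩,
    hκ0, hκd⟩
  · rw [IsPrimitiveRoot.coe_units_iff]
    exact IsPrimitiveRoot.orderOf ζ
  · rw [hl.img_mul_img hC hE, hcomm, Units.val_pow_eq_pow_val]

end Main

end CentralExt

theorem mainTheorem4 {k : Type*} [Field k] [IsAlgClosed k]
    {N E G : Type*} [CommGroup N] [Finite N] [Group E] [CommGroup G] [Group.FG G]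
    (S : GroupExtension N E G) (hS : S.inl.range ≤ Subgroup.center E) :
    (∃ C : Subgroup E, C ≤ Subgroup.center E ∧ C.FiniteIndex ∧ commutator E ≤ C) ∧
    ∀ (C : Subgroup E) [C.Normal], C ≤ Subgroup.center E → C.FiniteIndex →
      ∀ m : Ideal (MonoidAlgebra k C), m.IsMaximal →
        (∃ (α : TwoCocycle (E ⧸ C) kˣ) (Φ : Fiber C m ≃ₐ[k] TwistedGroupAlgebra k α),
          ∀ g : E, ∃ c : kˣ,
            Φ (img C m g) = (c : k) • TwistedGroupAlgebra.basis α (g : E ⧸ C)) ∧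
        (commutator E ≤ C →
          ∀ (n : ℕ) (x : Fin n → E),
            Subgroup.closure (Set.range fun i => (x i : E ⧸ C)) = ⊤ →
            (∃ (P : Matrix.GeneralLinearGroup (Fin n) ℤ) (d : ℕ) (ξ : k) (s : ℕ)
                (κ : Fin s → ZMod d),
              IsSkewNormalSystem C m x P d ξ κ ∧
                (∀ i, κ i ≠ 0) ∧ (∀ i j, i ≤ j → κ i ∣ κ j)) ∧
            (∀ (P : Matrix.GeneralLinearGroup (Fin n) ℤ) (d : ℕ) (ξ : k) (s : ℕ)
                (κ : Fin s → ZMod d),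
              IsSkewNormalSystem C m x P d ξ κ →
                ∀ (V : Type*) [AddCommGroup V] [Module k V] [Module (Fiber C m) V]
                  [IsScalarTower k (Fiber C m) V] [IsSimpleModule (Fiber C m) V],
                  Module.finrank k V = ∏ i, addOrderOf (κ i) ∧
                  Nonempty (stab C m V ≃*
                    Multiplicative (∀ i : Fin s,
                      ZMod (addOrderOf (κ i)) × ZMod (addOrderOf (κ i)))))) := by

  have hEfg := S.fg_of_finite
  refine ⟨S.exists_central_finiteIndex hS, fun C _ hC hfin m hm => ?_⟩
  obtain ⟨l, hl⟩ := exists_isCharacterKernel hEfg C hC m hm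
  refine ⟨⟨_, fiberEquivTwisted hC hl, fun g => ⟨_, fiberEquivTwisted_img hC hl g⟩⟩,
    fun hE n x hx => ⟨exists_isSkewNormalSystem hC hl hE hx, fun P d ξ s κ h V => ?_⟩⟩
  intro _ _ _ _ _
  exact finrank_and_stab_of_isSkewNormalSystem hC hl hE hx h V
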